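/- Let $X$ be a complex manifold of dimension $d$ (Hausdorff and second countable), let $L\to X$ be a holomorphic line bundle with a smooth hermitian metric $|\cdot|$, and let $s$ be a holomorphic section of $L$ whose zero set $D=\{s=0\}$ has normal crossings: around each $x\in X$ there are holomorphic coordinates $z=(z_1,\dots,z_d)$ centred at $x$ such that, in a local holomorphic frame, $s=z^{I}\varphi$ with $I=I(x)\in\mathbb{N}^d$ and $\varphi$ holomorphic and non-vanishing. Let $\omega$ be a quasi-meromorphic form of degree $k$ with polar set contained in $D$, that is, $\omega$ is a smooth form on $X\setminus D$ which locally can be written $\omega=\tilde\omega/(f\bar g)$ with $\tilde\omega$ smooth and $f,g\not\equiv0$ holomorphic. For each $x\in X$, fix coordinates as above and let $J=J(x)$, $K=K(x)\in\mathbb{N}^d$ be minimal multi-indices with $J_j=K_j=0$ whenever $I_j=0$ and such that $z^{J}\bar z^{K}\omega$ extends smoothly across $D$ near $x$. Assume that the maximum $$o_\omega(s)=\max_{x\in X}\ \prod_{j:\,J_j(x)\neq0,\ K_j(x)\neq0}I_j(x)$$ exists. Let $\xi$ be a test form (smooth, with compact support) of degree $2d-k$ and, for $\operatorname{Re}\lambda$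 sufficiently large, let $$F_\xi(\lambda)=o_\omega(s)\int_X|s|^{2\lambda}\,\omega\wedge\xi .$$ Then the integral converges absolutely for $\operatorname{Re}\lambda$ sufficiently large, $F_\xi$ has a meromorphic extension to $\mathbb{C}$, and every pole of the extension is a rational number less than or equal to $$\max\Big\{\min\Big\{\frac{J_j(x)-1}{I_j(x)},\frac{K_j(x)-1}{I_j(x)}\Big\}\ :\ x\in\operatorname{supp}\xi,\ 1\le j\le d,\ I_j(x)\neq0\Big\};$$ that is, each pole is at most one of the numbers in this set, and there are no poles if the set is empty. In particular, if for every $x\in\operatorname{supp}\xi$ and every $j$ one has $J_j(x)\le1$ or $K_j(x)\le1$, then $F_\xi$ has no poles in the half-plane $\operatorname{Re}\lambda>0$. -/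

import Mathlib

open scoped Manifold ContDiff Topology
open Set Bundle

noncomputable section

namespace QuasiMeromorphic

/-- The model space `ℂ^d`. -/
abbrev Cn (d : ℕ) : Type := Fin d → ℂ

/-! ### Exterior product of complex-valued real-multilinear alternating forms -/

section Wedge

variable {M : Type*} [AddCommGroup M] [Module ℝ M]

/-- The exterior product of alternating forms, as an alternating map of degree `n = k + l`:
the shuffle sum `∑ sign σ · a (v_{σ 1}, …, v_{σ k}) · b (v_{σ (k+1)}, …, v_{σ n})`. -/
def wedgeAux {k l n : ℕ} (h : k + l = n) (a : M [⋀^Fin k]→ₗ[ℝ] ℂ) (b : M [⋀^Fin l]→ₗ[ℝ] ℂ) :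
    M [⋀^Fin n]→ₗ[ℝ] ℂ :=
  ((LinearMap.mul' ℝ ℂ).compAlternatingMap (a.domCoprod b)).domDomCongr
    (finSumFinEquiv.trans (finCongr h))

variable [TopologicalSpace M]

theorem continuous_wedgeAux {k l n : ℕ} (h : k + l = n) (a : M [⋀^Fin k]→L[ℝ] ℂ)
    (b : M [⋀^Fin l]→L[ℝ] ℂ) :
    Continuous fun v : Fin n → M => wedgeAux h a.toAlternatingMap b.toAlternatingMap v := by
  simp only [wedgeAux, AlternatingMap.domDomCongr_apply, LinearMap.compAlternatingMap_apply,
    AlternatingMap.domCoprod_apply, sum_apply, map_sum]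
  refine continuous_finsetSum _ fun σ _ => ?_
  induction σ using Quotient.inductionOn' with
  | _ σ =>
    rw [AlternatingMap.domCoprod.summand_mk'']
    have ha : Continuous fun v : Fin n → M => a fun i =>
        v (finCongr h (finSumFinEquiv (σ (Sum.inl i)))) :=
      a.cont.comp (continuous_pi fun i => continuous_apply _)
    have hb : Continuous fun v : Fin n → M => b fun i =>
        v (finCongr h (finSumFinEquiv (σ (Sum.inr i)))) :=
      b.cont.comp (continuous_pi fun i => continuous_apply _)
    have := (ha.mul hb).const_smul (Equiv.Perm.sign σ)
    convert this using 2 with v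
    rcases Int.units_eq_one_or (Equiv.Perm.sign σ) with hs | hs <;> simp [hs]

/-- The exterior product `a ∧ b` of (continuous) alternating forms of degrees `k` and `l`,
of degree `n = k + l`. -/
def wedge {k l n : ℕ} (h : k + l = n) (a : M [⋀^Fin k]→L[ℝ] ℂ) (b : M [⋀^Fin l]→L[ℝ] ℂ) :
    M [⋀^Fin n]→L[ℝ] ℂ :=
  { wedgeAux h a.toAlternatingMap b.toAlternatingMap with
    cont := continuous_wedgeAux h a b }

end Wedge

/-! ### Differential forms on a complex manifold and their integrals -/

section Forms

variable {d : ℕ} {X : Type*} [TopologicalSpace X] [ChartedSpace (Cn d) X]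

variable (d X) in
/-- Complex-valued differential forms of degree `k` on `X` (no regularity required). At each point
a form is an alternating real-multilinear map on the real tangent space. -/
abbrev CForm (k : ℕ) : Type _ :=
  ∀ x : X, (TangentSpace 𝓘(ℝ, Cn d) x) [⋀^Fin k]→L[ℝ] ℂ

variable (d X) in
/-- Holomorphic coordinate systems on open subsets of `X`. -/
abbrev holCharts : Set (OpenPartialHomeomorph X (Cn d)) :=
  IsManifold.maximalAtlas 𝓘(ℂ, Cn d) ω X

/-- The expression of a form in the coordinates `e`, i.e. its pullback under `e⁻¹`; only meaningful
on `e.target`. -/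
def CForm.inChart {k : ℕ} (η : CForm d X k) (e : OpenPartialHomeomorph X (Cn d)) (z : Cn d) :
    (Cn d) [⋀^Fin k]→L[ℝ] ℂ :=
  (η (e.symm z)).compContinuousLinearMap (mfderiv 𝓘(ℝ, Cn d) 𝓘(ℝ, Cn d) e.symm z)

/-- The form `η` is smooth (`C^∞` in the real sense) on the open set `U`. -/
def CForm.SmoothOn {k : ℕ} (η : CForm d X k) (U : Set X) : Prop :=
  ∀ e ∈ holCharts d X, ContDiffOn ℝ ∞ (η.inChart e) (e.target ∩ e.symm ⁻¹' U)

/-- The (closed) support of a form. -/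
def CForm.support {k : ℕ} (η : CForm d X k) : Set X := closure {x | η x ≠ 0}

/-- The frame `∂/∂x₁, ∂/∂y₁, …, ∂/∂x_d, ∂/∂y_d` of `ℂ^d`, positive for the orientation of `ℂ^d`
as a complex vector space. -/
def stdFrame (d : ℕ) (i : Fin (2 * d)) : Cn d :=
  Pi.single ⟨(i : ℕ) / 2, by omega⟩ (if (i : ℕ) % 2 = 0 then 1 else Complex.I)

/-- The coefficient `f` of a form of top degree, written as
`f dx₁ ∧ dy₁ ∧ ⋯ ∧ dx_d ∧ dy_d` in the coordinates `e`. -/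
def CForm.topCoeff (η : CForm d X (2 * d)) (e : OpenPartialHomeomorph X (Cn d)) (z : Cn d) : ℂ :=
  η.inChart e z (stdFrame d)

/-- `HasIntegral η c`: the form `η` of top degree is (absolutely) integrable over `X`, with
integral `c`. Given a countable cover of `X` by domains of holomorphic charts `e n`, cut `X` into the
disjoint pieces `dom (e n) \ ⋃ m < n, dom (e m)` and sum up the Lebesgue integrals over the pieces,
each computed in its chart. The result has to be `c` for every such cover. -/
def CForm.HasIntegral (η : CForm d X (2 * d)) (c : ℂ) : Prop :=
  ∀ e : ℕ → OpenPartialHomeomorph X (Cn d), (∀ n, e n ∈ holCharts d X) →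
    (⋃ n, (e n).source) = univ →
    let piece : ℕ → Set (Cn d) := fun n =>
      (e n).target ∩ (e n).symm ⁻¹' (disjointed (fun m => (e m).source) n)
    (∀ n, MeasureTheory.IntegrableOn (η.topCoeff (e n)) (piece n)) ∧
    (Summable fun n => ∫ z in piece n, ‖η.topCoeff (e n) z‖) ∧
    HasSum (fun n => ∫ z in piece n, η.topCoeff (e n) z) c

/-- The form `η` of top degree is integrable over `X`. -/
def CForm.IsIntegrable (η : CForm d X (2 * d)) : Prop := ∃ c, η.HasIntegral c

open Classical in
/-- The integral `∫_X η` of a form of top degree (zero if `η` is not integrable). -/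
def CForm.integral (η : CForm d X (2 * d)) : ℂ :=
  if h : η.IsIntegrable then h.choose else 0

/-- The function `f` is holomorphic near `x` (on the complex manifold `X`). -/
def HolomorphicNear (f : X → ℂ) (x : X) : Prop := ContMDiffAt 𝓘(ℂ, Cn d) 𝓘(ℂ) ω f x

/-- The class `ℰ(*\bar{*}D)`: forms `α` on `X \ D` (the values on `D` are irrelevant) which are
smooth on `X \ D` and such that near each point of `X` one has `α = α' / (f \bar g)`, where `α'` is a
smooth form and `f`, `g` are holomorphic and not identically zero. -/
def IsQuasiMeromorphic {k : ℕ} (D : Set X) (α : CForm d X k) : Prop :=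
  α.SmoothOn Dᶜ ∧
  ∀ x : X, ∃ U : Set X, IsOpen U ∧ x ∈ U ∧ ∃ (f g : X → ℂ) (α' : CForm d X k),
    ContMDiffOn 𝓘(ℂ, Cn d) 𝓘(ℂ) ω f U ∧ ContMDiffOn 𝓘(ℂ, Cn d) 𝓘(ℂ) ω g U ∧
    (¬ ∀ᶠ y in 𝓝 x, f y = 0) ∧ (¬ ∀ᶠ y in 𝓝 x, g y = 0) ∧
    α'.SmoothOn U ∧
    ∀ y ∈ U \ D, (f y * (starRingEnd ℂ) (g y)) • α y = α' y

/-- The monomial `z^I = z₁^{I₁} ⋯ z_d^{I_d}`. -/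
def monomial (I : Fin d → ℕ) (z : Cn d) : ℂ := ∏ j, z j ^ I j

/-- In the coordinates `e` centred at `x`, with `D` given by `∏_{I_j ≠ 0} z_j = 0`, the multi-indices
`J`, `K` involve only those coordinates `z_j` which vanish on `D`, and `z^J \bar z^K α` extends from
the complement of `D` to a smooth form near `x`. -/
def BoundsPoles {k : ℕ} (D : Set X) (α : CForm d X k) (x : X)
    (e : OpenPartialHomeomorph X (Cn d)) (I : Fin d → ℕ)
    (JK : (Fin d → ℕ) × (Fin d → ℕ)) : Prop :=
  (∀ j, I j = 0 → JK.1 j = 0 ∧ JK.2 j = 0) ∧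
  ∃ U : Set X, IsOpen U ∧ x ∈ U ∧ U ⊆ e.source ∧ ∃ α' : CForm d X k, α'.SmoothOn U ∧
    ∀ y ∈ U \ D, (monomial JK.1 (e y) * (starRingEnd ℂ) (monomial JK.2 (e y))) • α y = α' y

end Forms

/-! ### Holomorphic line bundles -/

section LineBundle

variable {d : ℕ} {X : Type*} [TopologicalSpace X] [ChartedSpace (Cn d) X]
  (L : X → Type*) [TopologicalSpace (TotalSpace ℂ L)] [∀ x, AddCommGroup (L x)]
  [∀ x, Module ℂ (L x)] [∀ x, TopologicalSpace (L x)] [FiberBundle ℂ L]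

variable (d) in
/-- A (smooth, hermitian) metric on the line bundle `L`: a norm on each fibre, whose value on the
local frames given by trivializations is a smooth function. -/
structure LineBundleMetric where
  /-- The norm `|v|` of a vector `v` in the fibre over `x`. -/
  norm : ∀ x, L x → ℝ
  norm_smul : ∀ (x : X) (c : ℂ) (v : L x), norm x (c • v) = ‖c‖ * norm x v
  norm_pos : ∀ (x : X) (v : L x), v ≠ 0 → 0 < norm x v
  smooth : ∀ x₀ : X, ContMDiffOn 𝓘(ℝ, Cn d) 𝓘(ℝ, ℝ) ∞
    (fun x => norm x ((trivializationAt ℂ L x₀).symm x 1)) (trivializationAt ℂ L x₀).baseSet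

variable {L}

/-- In the coordinates `e` and a holomorphic frame of `L` near `x`, the section `s` is `z^I φ` with
`φ` holomorphic and non-vanishing near `x`. -/
def IsMonomialAt (s : ∀ x, L x) (x : X) (e : OpenPartialHomeomorph X (Cn d)) (I : Fin d → ℕ) :
    Prop :=
  ∃ φ : X → ℂ, HolomorphicNear (d := d) φ x ∧ φ x ≠ 0 ∧
    ∀ᶠ y in 𝓝 x, (trivializationAt ℂ L x ⟨y, s y⟩).2 = monomial I (e y) * φ y

/-- The local data at the point `x`: coordinates `e` centred at `x` in which `s` is the monomial
`z^I` times a non-vanishing function (so that `D = {s = 0}` is `∏_{I_j ≠ 0} z_j = 0` near `x`), and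
minimal multi-indices `J`, `K` such that `z^J \bar z^K α` is smooth near `x`. -/
def IsLocalData {k : ℕ} (s : ∀ x, L x) (α : CForm d X k) (x : X)
    (e : OpenPartialHomeomorph X (Cn d)) (I J K : Fin d → ℕ) : Prop :=
  e ∈ holCharts d X ∧ x ∈ e.source ∧ e x = 0 ∧ IsMonomialAt s x e I ∧
  Minimal (BoundsPoles {y | s y = 0} α x e I) (J, K)

/-- The number `o_{ω,x}(s)`: the product of the vanishing orders of `s` along the local components of
`D` on which the form has both holomorphic and anti-holomorphic poles. -/
def localOrder (I J K : Fin d → ℕ) : ℕ := ∏ j with J j ≠ 0 ∧ K j ≠ 0, I j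

/-- The form `|s|^{2λ} α ∧ ξ` of top degree. -/
def regularizedForm {k l : ℕ} (hkl : k + l = 2 * d) (h : LineBundleMetric d L) (s : ∀ x, L x)
    (α : CForm d X k) (ξ : CForm d X l) (lam : ℂ) : CForm d X (2 * d) :=
  fun x => ((h.norm x (s x) : ℂ) ^ (2 * lam)) • wedge hkl (α x) (ξ x)

/-- The function `F_ξ(λ) = o ∫_X |s|^{2λ} α ∧ ξ`. -/
def zetaF {k l : ℕ} (hkl : k + l = 2 * d) (h : LineBundleMetric d L) (s : ∀ x, L x)
    (α : CForm d X k) (ξ : CForm d X l) (o : ℕ) (lam : ℂ) : ℂ :=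
  o * (regularizedForm hkl h s α ξ lam).integral

/-- `G` is a meromorphic extension to `ℂ` of `F_ξ`, which is defined by a convergent integral for
`Re λ` sufficiently large. -/
def IsMeromorphicExtension {k l : ℕ} (hkl : k + l = 2 * d) (h : LineBundleMetric d L)
    (s : ∀ x, L x) (α : CForm d X k) (ξ : CForm d X l) (o : ℕ) (G : ℂ → ℂ) : Prop :=
  Meromorphic G ∧ ∃ c : ℝ, ∀ lam : ℂ, c < lam.re →
    (regularizedForm hkl h s α ξ lam).IsIntegrable ∧ G lam = zetaF hkl h s α ξ o lam

end LineBundle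

/-- The point `a` is a pole of the meromorphic function `G`. -/
def IsPole (G : ℂ → ℂ) (a : ℂ) : Prop := meromorphicOrderAt G a < 0

end QuasiMeromorphic

end

/-! Near a point of D, with |s| = |z^I| e^ψ and α = z^{-J} \bar z^{-K} α', the integral becomes ∫
|z^I|^{2λ} e^{2λψ} z^{-J} \bar z^{-K} χ with χ a test function. Everything rests on one identity in
one complex variable, ∂/∂ζ (|ζ|^{2ν} ζ^{m+1}) = (ν + m + 1) |ζ|^{2ν} ζ^m.

If J_j ≤ K_j, then z_j^{-J_j} \bar z_j^{-K_j} = |z_j|^{-2K_j} z_j^{K_j-J_j}; if J_j > K_j,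
conjugating the coordinate z_j exchanges the two orders and preserves Lebesgue measure
(`polarIntegrand_partialConj`). So the integrand is ∏ |z_j|^{2(I_jλ - M_j)} z_j^{m_j} times a smooth
factor, with M = max(J, K) and m = max(J, K) - min(J, K). Integration by parts in z_j
(`localZeta_integration_by_parts`) raises m_j by one at the price of dividing by I_jλ - M_j + m_j +
1. Once the m_j are large the integrand is bounded on a prescribed half plane and the integral is
holomorphic there.

The divisors are the factors in the functional equation of Γ. Hence the local integral times ∏
1/Γ(I_jλ - M_j + m_j + 1) is entire, and poles can occur only where I_jλ = min(J_j, K_j) - 1 - n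
with n ≥ 0 (`exists_meromorphic_polarIntegrand`). This is where the minimum in the bound comes from.

A partition of unity on supp ξ, subordinate to finitely many coordinate neighbourhoods centred at
points of supp ξ, writes the global integral as a finite sum of such local ones
(`exists_meromorphic_integral`). The identity theorem transfers the bound to every meromorphic
extension (`meromorphicOrderAt_eq_of_eq_halfPlane`). -/

noncomputable section

namespace QuasiMeromorphic

open MeasureTheory Filter

/-! ### Holomorphic dependence of integrals on a parameter -/

section ParametricIntegral

/-- An integral depending on a complex parameter is holomorphic if the integrand is, and is locally
uniformly dominated by integrable functions. -/
theorem differentiableOn_integral_of_locally_dominated {β : Type*} [MeasurableSpace β]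
    {μ : Measure β} {f : ℂ → β → ℂ} {U : Set ℂ} (hU : IsOpen U)
    (hmeas : ∀ w ∈ U, AEStronglyMeasurable (f w) μ)
    (hf : ∀ᵐ a ∂μ, DifferentiableOn ℂ (fun w => f w a) U)
    (hb : ∀ w ∈ U, ∃ s ∈ 𝓝 w, ∃ bound : β → ℝ, Integrable bound μ ∧
      ∀ᵐ a ∂μ, ∀ v ∈ s, ‖f v a‖ ≤ bound a) :
    DifferentiableOn ℂ (fun w => ∫ a, f w a ∂μ) U := by
  intro w hw
  obtain ⟨s, hs, bound, hbi, hbd⟩ := hb w hw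
  obtain ⟨ε, hε, hεs⟩ := Metric.mem_nhds_iff.1 (inter_mem hs (hU.mem_nhds hw))
  have hball : Metric.ball w (ε / 2) ∈ 𝓝 w := Metric.ball_mem_nhds _ (by positivity)
  have hd : ∀ᵐ a ∂μ, HasDerivAt (fun v => f v a) (deriv (fun v => f v a) w) w := by
    filter_upwards [hf] with a ha
    exact (ha.differentiableAt (hU.mem_nhds hw)).hasDerivAt
  -- The derivative is measurable as an a.e. limit of difference quotients along a sequence t n → 0,
  -- short enough for w + t n to stay in U.
  have hFm : AEStronglyMeasurable (fun a => deriv (fun v => f v a) w) μ := by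
    let t : ℕ → ℂ := fun n => ((ε / 2 / (n + 1) : ℝ) : ℂ)
    have ht0 : ∀ n, t n ≠ 0 := fun n => by
      simp only [t, ne_eq, Complex.ofReal_eq_zero]; positivity
    have htn : ∀ n, ‖t n‖ < ε := fun n => by
      simp only [t, Complex.norm_real, Real.norm_eq_abs]
      rw [abs_of_pos (by positivity)]
      calc ε / 2 / (n + 1) ≤ ε / 2 := div_le_self (by positivity) (by linarith [n.cast_nonneg (α := ℝ)])
        _ < ε := by linarith
    have htl : Tendsto t atTop (𝓝[≠] 0) := by
      refine tendsto_nhdsWithin_iff.2 ⟨?_, Eventually.of_forall ht0⟩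
      have h := (tendsto_const_div_atTop_nhds_zero_nat (ε / 2)).comp (tendsto_add_atTop_nat 1)
      have h2 := (Complex.continuous_ofReal.tendsto 0).comp h
      simpa [t, Function.comp_def] using h2
    refine aestronglyMeasurable_of_tendsto_ae atTop (f := fun n a => (t n)⁻¹ • (f (w + t n) a - f w a))
      (fun n => ?_) ?_
    · have hmem : w + t n ∈ U := (hεs (by simpa [Metric.mem_ball, dist_eq_norm] using htn n)).2
      exact ((hmeas _ hmem).sub (hmeas _ hw)).const_smul ((t n)⁻¹)
    · filter_upwards [hd] with a ha
      exact (hasDerivAt_iff_tendsto_slope_zero.1 ha).comp htl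
  refine ((hasDerivAt_integral_of_dominated_loc_of_deriv_le (F := f)
    (F' := fun v a => deriv (fun v => f v a) v) (bound := fun a => bound a / (ε / 2)) hball
    ?_ ?_ hFm ?_ (hbi.div_const _) ?_).2).differentiableAt.differentiableWithinAt
  · filter_upwards [hU.mem_nhds hw] with v hv using hmeas v hv
  · refine hbi.mono' (hmeas w hw) ?_
    filter_upwards [hbd] with a ha using ha w (mem_of_mem_nhds hs)
  · filter_upwards [hf, hbd] with a ha hba v hv
    have hsub : Metric.closedBall v (ε / 2) ⊆ Metric.ball w ε := by
      intro y hy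
      rw [Metric.mem_ball] at hv ⊢
      rw [Metric.mem_closedBall] at hy
      linarith [dist_triangle y v w]
    -- Cauchy's estimate on the circle of radius ε/2 about v turns the bound on f into the bound
    -- `bound a / (ε / 2)` on its derivative.
    refine Complex.norm_deriv_le_of_forall_mem_sphere_norm_le (by positivity) ?_ ?_
    · refine DifferentiableOn.diffContOnCl_ball (U := U) ha ?_
      exact fun y hy => (hεs (hsub hy)).2
    · exact fun y hy => hba y (hεs (hsub (Metric.sphere_subset_closedBall hy))).1
  · filter_upwards [hf] with a ha v hv
    have : v ∈ U := (hεs (Metric.ball_subset_ball (by linarith) hv)).2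
    exact (ha.differentiableAt (hU.mem_nhds this)).hasDerivAt

end ParametricIntegral

/-! ### One-variable powers |ζ|^{2ν} ζ^m and their Wirtinger derivative -/

section RadialPower

/-- The function `|ζ|^{2ν} ζ^m` on the complex line. -/
def radialPow (ν : ℂ) (m : ℕ) (ζ : ℂ) : ℂ := ((Complex.normSq ζ : ℝ) : ℂ) ^ ν * ζ ^ m

theorem norm_radialPow {ν : ℂ} {m : ℕ} {ζ : ℂ} (hζ : ζ ≠ 0) :
    ‖radialPow ν m ζ‖ = ‖ζ‖ ^ (2 * ν.re + m) := by
  have h0 : 0 < ‖ζ‖ := norm_pos_iff.2 hζ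
  rw [radialPow, norm_mul, Complex.norm_cpow_eq_rpow_re_of_pos (Complex.normSq_pos.2 hζ), norm_pow,
    Real.rpow_add h0, Real.rpow_mul h0.le, Real.rpow_natCast, Complex.normSq_eq_norm_sq]
  norm_cast

theorem differentiable_radialPow_exponent {m : ℕ} {ζ : ℂ} (hζ : ζ ≠ 0) {g : ℂ → ℂ}
    (hg : Differentiable ℂ g) : Differentiable ℂ fun w => radialPow (g w) m ζ := by
  refine Differentiable.mul_const (fun w => ?_) _
  exact (hg w).const_cpow (Or.inl (by simpa using hζ))

theorem continuous_normSq_cpow {ν : ℂ} (hν : 0 < ν.re) :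
    Continuous fun ζ : ℂ => ((Complex.normSq ζ : ℝ) : ℂ) ^ ν :=
  continuous_iff_continuousAt.2 fun _ =>
    ContinuousAt.comp (f := fun ζ : ℂ => Complex.normSq ζ) (g := fun t : ℝ => (t : ℂ) ^ ν)
      (Complex.continuousAt_ofReal_cpow_const _ _ (Or.inl hν))
      Complex.continuous_normSq.continuousAt

theorem continuous_radialPow {ν : ℂ} (hν : 0 < ν.re) (m : ℕ) : Continuous (radialPow ν m) :=
  (continuous_normSq_cpow hν).mul (continuous_id.pow m)

theorem measurable_radialPow (ν : ℂ) (m : ℕ) : Measurable (radialPow ν m) := by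
  unfold radialPow
  fun_prop

/-- Away from 0 this is the chain rule along a line. At 0 both sides are computed directly; the
assumption Re ν > 1 also makes the exponent ν - 1 in the derivative harmless. -/
theorem hasDerivAt_normSq_cpow_line {ν : ℂ} (hν : 1 < ν.re) (ζ v : ℂ) :
    HasDerivAt (fun t : ℝ => ((Complex.normSq (ζ + t * v) : ℝ) : ℂ) ^ ν)
      (ν * ((Complex.normSq ζ : ℝ) : ℂ) ^ (ν - 1) * (2 * (ζ * (starRingEnd ℂ) v).re : ℝ)) 0 := by
  have hν0 : ν ≠ 0 := by rintro rfl; simp at hν; linarith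
  by_cases hζ : ζ = 0
  · subst hζ
    have hν1 : ν - 1 ≠ 0 := by
      intro h; have := congrArg Complex.re h; simp at this; linarith
    simp only [Complex.normSq_zero, Complex.ofReal_zero, Complex.zero_cpow hν1, zero_add, mul_zero,
      zero_mul]
    rw [hasDerivAt_iff_isLittleO]
    simp only [sub_zero, Complex.ofReal_zero, zero_mul, Complex.normSq_zero,
      Complex.zero_cpow hν0, smul_zero]
    -- The function is O(|t|^{2 Re ν}), and this is o(t) because 2 Re ν > 1.
    have h1 : (fun t : ℝ => ((Complex.normSq ((t : ℂ) * v) : ℝ) : ℂ) ^ ν) =O[𝓝 0]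
        fun t : ℝ => |t| ^ (2 * ν.re) := by
      refine Asymptotics.IsBigO.of_bound (‖v‖ ^ (2 * ν.re)) (Eventually.of_forall fun t => ?_)
      rw [Complex.normSq_eq_norm_sq, Complex.norm_cpow_eq_rpow_re_of_nonneg (by positivity)
        (by linarith), norm_mul, Complex.norm_real, Real.norm_eq_abs,
        Real.norm_of_nonneg (by positivity), ← Real.rpow_natCast, ← Real.rpow_mul (by positivity),
        Real.mul_rpow (by positivity) (by positivity)]
      exact (mul_comm _ _).le
    refine h1.trans_isLittleO ?_
    have h2 : (fun t : ℝ => |t| ^ (2 * ν.re)) = fun t : ℝ => |t| ^ (2 * ν.re - 1) * |t| := by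
      funext t
      rcases eq_or_ne t 0 with rfl | ht
      · simp only [abs_zero, mul_zero]; exact Real.zero_rpow (by linarith)
      · rw [← Real.rpow_add_one (abs_ne_zero.2 ht)]; congr 1; ring
    rw [h2]
    have h3 : (fun t : ℝ => |t| ^ (2 * ν.re - 1)) =o[𝓝 0] fun _ => (1 : ℝ) := by
      rw [Asymptotics.isLittleO_one_iff]
      have : ContinuousAt (fun t : ℝ => |t| ^ (2 * ν.re - 1)) 0 :=
        continuous_abs.continuousAt.rpow_const (Or.inr (by linarith))
      have h4 := this.tendsto
      rwa [abs_zero, Real.zero_rpow (by linarith)] at h4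
    simpa using h3.mul_isBigO (Asymptotics.isBigO_refl (fun t : ℝ => |t|) (𝓝 0))
      |>.trans_isBigO (Asymptotics.IsBigO.of_bound 1 (Eventually.of_forall fun t => by simp))
  · have hpos : Complex.normSq ζ ≠ 0 := by simpa using hζ
    have hline : HasDerivAt (fun t : ℝ => Complex.normSq (ζ + t * v))
        (2 * (ζ * (starRingEnd ℂ) v).re) 0 := by
      have hE : (fun t : ℝ => Complex.normSq (ζ + t * v)) = fun t : ℝ =>
          Complex.normSq ζ + t ^ 2 * Complex.normSq v + t * (2 * (ζ * (starRingEnd ℂ) v).re) := by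
        funext t
        simp only [Complex.normSq_apply, Complex.mul_re, Complex.add_re, Complex.add_im,
          Complex.mul_im, Complex.ofReal_re, Complex.ofReal_im, Complex.conj_re, Complex.conj_im]
        ring
      rw [hE]
      exact ((((hasDerivAt_id' (0 : ℝ)).pow 2).mul_const (Complex.normSq v)).const_add
        (Complex.normSq ζ) |>.add ((hasDerivAt_id' (0 : ℝ)).mul_const
          (2 * (ζ * (starRingEnd ℂ) v).re))).congr_deriv (by simp)
    have hpow : HasDerivAt (fun t : ℝ => (t : ℂ) ^ ν)
        (ν * ((Complex.normSq ζ : ℝ) : ℂ) ^ (ν - 1)) (Complex.normSq ζ) :=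
      hasDerivAt_ofReal_cpow_const hpos hν0
    have := HasDerivAt.scomp (𝕜 := ℝ) (𝕜' := ℝ) (0 : ℝ) (h := fun t : ℝ => Complex.normSq (ζ + t * v))
      (by simpa using hpow) hline
    simpa [Function.comp_def, mul_comm] using this

/-- The derivative at `ζ` of `radialPow ν (m + 1)` in the direction `v`. -/
def radialPowDeriv (ν : ℂ) (m : ℕ) (v ζ : ℂ) : ℂ :=
  ν * ((Complex.normSq ζ : ℝ) : ℂ) ^ (ν - 1) * (2 * (ζ * (starRingEnd ℂ) v).re : ℝ) * ζ ^ (m + 1) +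
    ((Complex.normSq ζ : ℝ) : ℂ) ^ ν * ((m + 1 : ℕ) * ζ ^ m * v)

theorem hasDerivAt_radialPow_line {ν : ℂ} (hν : 1 < ν.re) (m : ℕ) (ζ v : ℂ) :
    HasDerivAt (fun t : ℝ => radialPow ν (m + 1) (ζ + t * v)) (radialPowDeriv ν m v ζ) 0 := by
  have h1 := hasDerivAt_normSq_cpow_line hν ζ v
  have h2 : HasDerivAt (fun t : ℝ => (ζ + t * v) ^ (m + 1)) ((m + 1 : ℕ) * ζ ^ m * v) 0 := by
    have h3 : HasDerivAt (fun t : ℝ => ζ + (t : ℂ) * v) v 0 := by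
      simpa using ((Complex.ofRealCLM.hasDerivAt (x := (0 : ℝ))).mul_const v).const_add ζ
    exact (h3.pow (m + 1)).congr_deriv (by simp)
  exact (h1.mul h2).congr_deriv (by simp [radialPowDeriv])

theorem continuous_radialPowDeriv {ν : ℂ} (hν : 1 < ν.re) (m : ℕ) (v : ℂ) :
    Continuous (radialPowDeriv ν m v) := by
  have h1 := continuous_normSq_cpow (ν := ν) (by linarith)
  have h2 := continuous_normSq_cpow (ν := ν - 1) (by simpa using hν)
  unfold radialPowDeriv
  fun_prop

/-- Formally |ζ|^{2ν} ζ^{m+1} = ζ^{ν+m+1} \bar ζ^ν, and ∂/∂ζ treats \bar ζ as a constant. The factor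
ν + m + 1 is the source of all poles. -/
theorem radialPowDeriv_wirtinger {ν : ℂ} (hν : 1 < ν.re) (m : ℕ) (ζ : ℂ) :
    (radialPowDeriv ν m 1 ζ - Complex.I * radialPowDeriv ν m Complex.I ζ) / 2 =
      (ν + m + 1) * radialPow ν m ζ := by
  have hν0 : ν ≠ 0 := by rintro rfl; simp at hν; linarith
  have hsplit : ((Complex.normSq ζ : ℝ) : ℂ) ^ ν =
      ((Complex.normSq ζ : ℝ) : ℂ) ^ (ν - 1) * (ζ * (starRingEnd ℂ) ζ) := by
    rw [Complex.mul_conj]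
    by_cases hζ : ζ = 0
    · subst hζ; simp [Complex.zero_cpow hν0]
    · have : ((Complex.normSq ζ : ℝ) : ℂ) ≠ 0 := by simpa using hζ
      rw [Complex.cpow_sub _ _ this, Complex.cpow_one, div_mul_cancel₀ _ this]
  simp only [radialPowDeriv, radialPow]
  have hre : ((2 * (ζ * (starRingEnd ℂ) 1).re : ℝ) : ℂ) -
      Complex.I * ((2 * (ζ * (starRingEnd ℂ) Complex.I).re : ℝ) : ℂ) = 2 * (starRingEnd ℂ) ζ := by
    apply Complex.ext <;> simp
  rw [hsplit]
  set P := ((Complex.normSq ζ : ℝ) : ℂ) ^ (ν - 1)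
  set A := ((2 * (ζ * (starRingEnd ℂ) 1).re : ℝ) : ℂ)
  set B := ((2 * (ζ * (starRingEnd ℂ) Complex.I).re : ℝ) : ℂ)
  have hA : A = 2 * (starRingEnd ℂ) ζ + Complex.I * B := by rw [← hre]; ring
  rw [hA]
  have hI : Complex.I * Complex.I = -1 := Complex.I_mul_I
  push_cast
  linear_combination (-(P * (ζ * (starRingEnd ℂ) ζ) * ((m + 1) * ζ ^ m)) / 2) * hI

end RadialPower

/-! ### The local zeta integral: convergence, holomorphy, integration by parts -/

section LocalZeta

variable {d : ℕ}

/-- The weight `∏_j |z_j|^{2(I_j λ - K_j)} z_j^{m_j}`. -/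
def weight (I K m : Fin d → ℕ) (lam : ℂ) (z : Cn d) : ℂ :=
  ∏ j, radialPow (I j * lam - K j) (m j) (z j)

/-- The integrand `∏_j |z_j|^{2(I_j λ - K_j)} z_j^{m_j} e^{λψ} χ`. -/
def localIntegrand (I K m : Fin d → ℕ) (ψ χ : Cn d → ℂ) (lam : ℂ) (z : Cn d) : ℂ :=
  weight I K m lam z * (Complex.exp (lam * ψ z) * χ z)

/-- The local zeta integral `∫ ∏_j |z_j|^{2(I_j λ - K_j)} z_j^{m_j} e^{λψ} χ`. -/
def localZeta (I K m : Fin d → ℕ) (ψ χ : Cn d → ℂ) (lam : ℂ) : ℂ :=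
  ∫ z, localIntegrand I K m ψ χ lam z

/-- Discarding the coordinate hyperplanes frees pointwise identities from the conventional values of
powers and inverses at 0. -/
theorem ae_coord_ne_zero : ∀ᵐ z : Cn d, ∀ j, z j ≠ 0 := by
  rw [ae_all_iff]
  intro j
  exact (Measure.quasiMeasurePreserving_eval (fun _ : Fin d => (volume : Measure ℂ)) j).ae
    (p := fun x : ℂ => x ≠ 0) (by simp [ae_iff])

theorem measurable_weight (I K m : Fin d → ℕ) (lam : ℂ) : Measurable (weight I K m lam) :=
  Finset.measurable_fun_prod _ fun j _ => (measurable_radialPow _ _).comp (measurable_pi_apply j)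

theorem aestronglyMeasurable_localIntegrand (I K m : Fin d → ℕ) {ψ χ : Cn d → ℂ}
    (hψ : Continuous ψ) (hχ : Continuous χ) (lam : ℂ) :
    AEStronglyMeasurable (localIntegrand I K m ψ χ lam) := by
  refine ((measurable_weight I K m lam).mul ?_).aestronglyMeasurable
  exact (Complex.continuous_exp.comp (continuous_const.mul hψ)).mul hχ |>.measurable

theorem norm_weight_le {I K m : Fin d → ℕ} {lam : ℂ} {R B : ℝ} (hB : 1 ≤ B) (hR : ‖lam‖ ≤ R)
    (hpos : ∀ j, 0 ≤ 2 * (I j * lam.re - K j) + m j) {z : Cn d} (hz : ∀ j, z j ≠ 0)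
    (hzB : ‖z‖ ≤ B) :
    ‖weight I K m lam z‖ ≤ ∏ j, B ^ (2 * (I j * R) + m j) := by
  rw [weight, norm_prod]
  refine Finset.prod_le_prod (fun _ _ => norm_nonneg _) fun j _ => ?_
  rw [norm_radialPow (hz j)]
  have h1 : ((I j : ℂ) * lam - K j).re = I j * lam.re - K j := by simp
  rw [h1]
  have h2 : lam.re ≤ R := (Complex.re_le_norm _).trans hR
  have h3 : (I j : ℝ) * lam.re ≤ I j * R := by gcongr
  calc ‖z j‖ ^ (2 * (I j * lam.re - K j) + m j) ≤ B ^ (2 * (I j * lam.re - K j) + m j) :=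
        Real.rpow_le_rpow (norm_nonneg _) ((norm_le_pi_norm z j).trans hzB) (hpos j)
    _ ≤ _ := by
        refine Real.rpow_le_rpow_of_exponent_le hB ?_
        have : (0 : ℝ) ≤ K j := Nat.cast_nonneg _
        linarith

/-- The bound depends on λ only through R, so it yields both integrability at one λ and the locally
uniform domination needed for holomorphy. Nonnegative total exponents keep the weight bounded on the
support of χ. -/
theorem exists_bound_localIntegrand (I K m : Fin d → ℕ) {ψ χ : Cn d → ℂ} (hψ : Continuous ψ)
    (hχ : Continuous χ) (hc : HasCompactSupport χ) (R : ℝ) :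
    ∃ bound : Cn d → ℝ, Integrable bound ∧ ∀ z : Cn d, (∀ j, z j ≠ 0) → ∀ lam : ℂ, ‖lam‖ ≤ R →
      (∀ j, 0 ≤ 2 * (I j * lam.re - K j) + m j) →
      ‖localIntegrand I K m ψ χ lam z‖ ≤ bound z := by
  obtain ⟨B, hB⟩ := hc.isCompact.isBounded.exists_norm_le
  let C := ∏ j, (max 1 B) ^ (2 * (I j * R) + m j)
  refine ⟨fun z => C * (Real.exp (R * ‖ψ z‖) * ‖χ z‖), ?_, fun z hz lam hl hp => ?_⟩
  · have : Continuous fun z => C * (Real.exp (R * ‖ψ z‖) * ‖χ z‖) := by fun_prop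
    refine this.integrable_of_hasCompactSupport ?_
    exact (hc.norm.mul_left).mul_left
  · by_cases hz0 : χ z = 0
    · simp [localIntegrand, hz0]
    rw [localIntegrand, norm_mul]
    have hzB : ‖z‖ ≤ max 1 B := (hB z (subset_tsupport _ hz0)).trans (le_max_right _ _)
    refine mul_le_mul (norm_weight_le (le_max_left _ _) hl hp hz hzB) ?_ (by positivity)
      (Finset.prod_nonneg fun _ _ => by positivity)
    rw [norm_mul]
    refine mul_le_mul_of_nonneg_right ?_ (norm_nonneg _)
    · rw [Complex.norm_exp]
      refine Real.exp_le_exp.2 ?_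
      calc (lam * ψ z).re ≤ ‖lam * ψ z‖ := Complex.re_le_norm _
        _ ≤ R * ‖ψ z‖ := by rw [norm_mul]; gcongr

theorem integrable_localIntegrand {I K m : Fin d → ℕ} {ψ χ : Cn d → ℂ} (hψ : Continuous ψ)
    (hχ : Continuous χ) (hc : HasCompactSupport χ) {lam : ℂ}
    (hpos : ∀ j, 0 ≤ 2 * (I j * lam.re - K j) + m j) :
    Integrable (localIntegrand I K m ψ χ lam) := by
  obtain ⟨b, hb, hle⟩ := exists_bound_localIntegrand I K m hψ hχ hc ‖lam‖
  refine hb.mono' (aestronglyMeasurable_localIntegrand I K m hψ hχ lam) ?_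
  filter_upwards [ae_coord_ne_zero] with z hz using hle z hz lam le_rfl hpos

theorem differentiableOn_localZeta {I K m : Fin d → ℕ} {ψ χ : Cn d → ℂ} (hψ : Continuous ψ)
    (hχ : Continuous χ) (hc : HasCompactSupport χ) {U : Set ℂ} (hU : IsOpen U)
    (hpos : ∀ lam ∈ U, ∀ j, 0 ≤ 2 * (I j * lam.re - K j) + m j) :
    DifferentiableOn ℂ (localZeta I K m ψ χ) U := by
  refine differentiableOn_integral_of_locally_dominated hU
    (fun lam _ => aestronglyMeasurable_localIntegrand I K m hψ hχ lam) ?_ fun lam hlam => ?_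
  · filter_upwards [ae_coord_ne_zero] with z hz
    refine Differentiable.differentiableOn (Differentiable.mul ?_ (by fun_prop))
    unfold weight
    refine Differentiable.fun_finsetProd fun j _ => ?_
    exact differentiable_radialPow_exponent (hz j) (by fun_prop)
  · obtain ⟨b, hb, hle⟩ := exists_bound_localIntegrand I K m hψ hχ hc (‖lam‖ + 1)
    refine ⟨U ∩ Metric.ball lam 1, inter_mem (hU.mem_nhds hlam) (Metric.ball_mem_nhds _ one_pos),
      b, hb, ?_⟩
    filter_upwards [ae_coord_ne_zero] with z hz v hv
    refine hle z hz v ?_ (hpos v hv.1)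
    have h1 := hv.2
    rw [Metric.mem_ball, dist_eq_norm] at h1
    have := norm_le_insert' v lam
    linarith

/-- The Wirtinger derivative `∂f/∂z_j`. -/
def wirtinger (j : Fin d) (f : Cn d → ℂ) (z : Cn d) : ℂ :=
  (fderiv ℝ f z (Pi.single j 1) - Complex.I * fderiv ℝ f z (Pi.single j Complex.I)) / 2

theorem contDiff_wirtinger {j : Fin d} {f : Cn d → ℂ} (hf : ContDiff ℝ ∞ f) :
    ContDiff ℝ ∞ (wirtinger j f) := by
  have h : ContDiff ℝ ∞ (fderiv ℝ f) := hf.fderiv_right (by simp)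
  have h1 := h.clm_apply (contDiff_const (c := (Pi.single j 1 : Cn d)))
  have h2 := h.clm_apply (contDiff_const (c := (Pi.single j Complex.I : Cn d)))
  exact (h1.sub (contDiff_const.mul h2)).div_const 2

theorem hasCompactSupport_wirtinger {j : Fin d} {f : Cn d → ℂ} (hf : HasCompactSupport f) :
    HasCompactSupport (wirtinger j f) := by
  have h := hf.fderiv (𝕜 := ℝ)
  refine h.mono fun z hz => ?_
  rw [Function.mem_support] at hz ⊢
  contrapose! hz
  simp [wirtinger, hz]

theorem hasLineDerivAt_weight {I K m : Fin d → ℕ} {lam : ℂ} {j : Fin d}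
    (hj : 1 < ((I j : ℂ) * lam - K j).re) (v : ℂ) (z : Cn d) :
    HasLineDerivAt ℝ (weight I K (m + Pi.single j 1) lam)
      (radialPowDeriv (I j * lam - K j) (m j) v (z j) *
        ∏ i ∈ Finset.univ.erase j, radialPow (I i * lam - K i) (m i) (z i)) z (Pi.single j v) := by
  have h1 := (hasDerivAt_radialPow_line hj (m j) (z j) v).mul_const
    (∏ i ∈ Finset.univ.erase j, radialPow (I i * lam - K i) (m i) (z i))
  unfold HasLineDerivAt
  refine h1.congr_of_eventuallyEq (Eventually.of_forall fun t => ?_)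
  beta_reduce
  rw [weight, ← Finset.mul_prod_erase _ _ (Finset.mem_univ j)]
  congr 1
  · simp
  · refine Finset.prod_congr rfl fun i hi => ?_
    have hij : i ≠ j := Finset.ne_of_mem_erase hi
    simp [Pi.single_eq_of_ne hij]

/-- If I_j = 0 then K_j = 0, the radial exponent is 0, and the convention 0^0 = 1 leaves the
polynomial factor z_j^{m_j}. The other factors have radial exponent of positive real part. -/
theorem continuous_weight {I K m : Fin d → ℕ} {lam : ℂ} (hK : ∀ j, I j = 0 → K j = 0)
    (hlam : ∀ j, I j ≠ 0 → 1 < ((I j : ℂ) * lam - K j).re) : Continuous (weight I K m lam) := by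
  refine continuous_finsetProd _ fun j _ => ?_
  by_cases hj : I j = 0
  · simp only [hj, hK j hj, radialPow]
    simp only [Nat.cast_zero, zero_mul, sub_zero, Complex.cpow_zero, one_mul]
    fun_prop
  · exact (continuous_radialPow (by linarith [hlam j hj]) _).comp (continuous_apply j)

theorem continuous_prod_erase_radialPow {I K m : Fin d → ℕ} {lam : ℂ} (hK : ∀ j, I j = 0 → K j = 0)
    (hlam : ∀ j, I j ≠ 0 → 1 < ((I j : ℂ) * lam - K j).re) (j : Fin d) :
    Continuous fun z : Cn d =>
      ∏ i ∈ Finset.univ.erase j, radialPow (I i * lam - K i) (m i) (z i) := by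
  refine continuous_finsetProd _ fun j _ => ?_
  by_cases hj : I j = 0
  · simp only [hj, hK j hj, radialPow]
    simp only [Nat.cast_zero, zero_mul, sub_zero, Complex.cpow_zero, one_mul]
    fun_prop
  · exact (continuous_radialPow (by linarith [hlam j hj]) _).comp (continuous_apply j)

/-- Integration by parts in the direction `∂/∂z_j`. -/
theorem localZeta_integration_by_parts {I K m : Fin d → ℕ} {ψ χ : Cn d → ℂ}
    (hψ : ContDiff ℝ ∞ ψ) (hχ : ContDiff ℝ ∞ χ) (hc : HasCompactSupport χ) {lam : ℂ}
    (hK : ∀ j, I j = 0 → K j = 0) (hlam : ∀ j, I j ≠ 0 → 1 < ((I j : ℂ) * lam - K j).re)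
    {j : Fin d} (hj : I j ≠ 0) :
    (I j * lam - K j + m j + 1) * localZeta I K m ψ χ lam =
      -localZeta I K (m + Pi.single j 1) ψ (wirtinger j χ) lam
        - lam * localZeta I K (m + Pi.single j 1) ψ (fun z => χ z * wirtinger j ψ z) lam := by
  set u : Cn d → ℂ := fun z => Complex.exp (lam * ψ z) * χ z with hu
  have hexp : ContDiff ℝ ∞ fun z => Complex.exp (lam * ψ z) :=
    (contDiff_const.mul hψ).cexp
  have hus : ContDiff ℝ ∞ u := hexp.mul hχ
  have huc : HasCompactSupport u := hc.mul_left
  have hud : Differentiable ℝ u := hus.differentiable (by simp)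
  set w := weight I K (m + Pi.single j 1) lam with hw
  have hwc : Continuous w := continuous_weight hK hlam
  set w' : ℂ → Cn d → ℂ := fun v z => radialPowDeriv (I j * lam - K j) (m j) v (z j) *
        ∏ i ∈ Finset.univ.erase j, radialPow (I i * lam - K i) (m i) (z i) with hw'
  have hw'c : ∀ v, Continuous (w' v) := fun v =>
    ((continuous_radialPowDeriv (hlam j hj) _ _).comp (continuous_apply j)).mul
      (continuous_prod_erase_radialPow hK hlam j)
  have hfu : Continuous (fderiv ℝ u) := hus.continuous_fderiv (by simp)
  have hfuc : HasCompactSupport (fderiv ℝ u) := huc.fderiv (𝕜 := ℝ)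
  have hfuv : ∀ v, Continuous fun z => fderiv ℝ u z v := fun v => hfu.clm_apply continuous_const
  have hfuvc : ∀ v, HasCompactSupport fun z => fderiv ℝ u z v := fun v =>
    hfuc.mono fun z hz => by
      rw [Function.mem_support] at hz ⊢; contrapose! hz; simp [hz]
  have hi1 : ∀ v, Integrable fun z => w' v z * u z := fun v =>
    ((hw'c v).mul hus.continuous).integrable_of_hasCompactSupport huc.mul_left
  have hi2 : ∀ v, Integrable fun z => w z * fderiv ℝ u z v := fun v =>
    (hwc.mul (hfuv v)).integrable_of_hasCompactSupport (hfuvc v).mul_left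
  have hi3 : Integrable fun z => w z * u z :=
    (hwc.mul hus.continuous).integrable_of_hasCompactSupport huc.mul_left
  -- There is no boundary term since u has compact support, and w need only be differentiable along
  -- the line in direction v.
  have hibp : ∀ v : ℂ, ∫ z, w z * fderiv ℝ u z (Pi.single j v) = -∫ z, w' v z * u z := fun v => by
    have := integral_bilinear_hasLineDerivAt_right_eq_neg_left_of_integrable (μ := volume)
      (f := w) (f' := w' v) (g := u) (g' := fun z => fderiv ℝ u z (Pi.single j v))
      (v := Pi.single j v) (B := ContinuousLinearMap.mul ℝ ℂ) (hi1 v) (hi2 _) hi3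
      (fun z _ => hasLineDerivAt_weight (hlam j hj) v z)
      (fun z _ => (hud z).hasFDerivAt.hasLineDerivAt _)
    simpa using this
  have hL : (I j * lam - K j + m j + 1) * localZeta I K m ψ χ lam =
      ((∫ z, w' 1 z * u z) - Complex.I * ∫ z, w' Complex.I z * u z) / 2 := by
    rw [localZeta, ← integral_const_mul, ← integral_const_mul, ← integral_sub (hi1 _)
      ((hi1 _).const_mul _), ← integral_div]
    refine integral_congr_ae (Eventually.of_forall fun z => ?_)
    have h1 := radialPowDeriv_wirtinger (hlam j hj) (m j) (z j)
    simp only [hw', localIntegrand, weight]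
    rw [← Finset.mul_prod_erase _ _ (Finset.mem_univ j)]
    linear_combination (-(∏ i ∈ Finset.univ.erase j, radialPow (I i * lam - K i) (m i) (z i)) * u z)
      * h1
  -- The summand with the factor λ comes from differentiating e^{λψ}; it accounts for the second
  -- integral on the right.
  have hwirt : ∀ z, wirtinger j u z =
      Complex.exp (lam * ψ z) * wirtinger j χ z +
        lam * (Complex.exp (lam * ψ z) * (χ z * wirtinger j ψ z)) := fun z => by
    have h1 : HasFDerivAt u _ z := (((hψ.differentiable (by simp) z).hasFDerivAt.const_mul
      lam).cexp).mul (hχ.differentiable (by simp) z).hasFDerivAt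
    simp only [wirtinger, h1.fderiv]
    simp
    ring
  have hR : localZeta I K (m + Pi.single j 1) ψ (wirtinger j χ) lam
        + lam * localZeta I K (m + Pi.single j 1) ψ (fun z => χ z * wirtinger j ψ z) lam =
      ((∫ z, w z * fderiv ℝ u z (Pi.single j 1)) -
        Complex.I * ∫ z, w z * fderiv ℝ u z (Pi.single j Complex.I)) / 2 := by
    have ha : Integrable (localIntegrand I K (m + Pi.single j 1) ψ (wirtinger j χ) lam) :=
      (hwc.mul (hexp.continuous.mul
        (contDiff_wirtinger hχ).continuous)).integrable_of_hasCompactSupport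
        ((hasCompactSupport_wirtinger hc).mul_left.mul_left)
    have hb : Integrable (localIntegrand I K (m + Pi.single j 1) ψ
        (fun z => χ z * wirtinger j ψ z) lam) :=
      (hwc.mul (hexp.continuous.mul
        (hχ.continuous.mul (contDiff_wirtinger hψ).continuous))).integrable_of_hasCompactSupport
        (hc.mul_right.mul_left.mul_left)
    rw [localZeta, localZeta, ← integral_const_mul, ← integral_const_mul, ← integral_sub (hi2 _)
      ((hi2 _).const_mul _), ← integral_div, ← integral_add ha (hb.const_mul _)]
    refine integral_congr_ae (Eventually.of_forall fun z => ?_)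
    simp only [localIntegrand, ← hw]
    have h1 := hwirt z
    rw [wirtinger] at h1
    linear_combination (-w z) * h1
  rw [hibp, hibp] at hR
  rw [hL]
  linear_combination hR

end LocalZeta

/-! ### Meromorphic continuation in coordinates: gamma factors and reduction by conjugation -/

section Continuation

theorem isOpen_re_gt (r : ℝ) : IsOpen {w : ℂ | r < w.re} :=
  isOpen_lt continuous_const Complex.continuous_re

/-- Holomorphic functions on right half planes which agree far to the right agree where both are
defined. -/
theorem eqOn_of_eqOn_halfPlane {f g : ℂ → ℂ} {r c : ℝ} (hf : DifferentiableOn ℂ f {w | r < w.re})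
    (hg : DifferentiableOn ℂ g {w | r < w.re}) (hfg : ∀ w : ℂ, r < w.re → c < w.re → f w = g w) :
    ∀ w : ℂ, r < w.re → f w = g w := by
  have hconv : Convex ℝ {w : ℂ | r < w.re} := convex_halfSpace_re_gt r
  have hmem : ((max r c + 1 : ℝ) : ℂ) ∈ {w : ℂ | r < w.re} := by
    simp only [mem_ofPred_eq, Complex.ofReal_re]
    linarith [le_max_left r c]
  intro w hw
  refine (hf.analyticOnNhd (isOpen_re_gt r)).eqOn_of_preconnected_of_eventuallyEq
    (hg.analyticOnNhd (isOpen_re_gt r)) hconv.isPreconnected hmem ?_ hw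
  have hopen : {w : ℂ | max r c < w.re} ∈ 𝓝 ((max r c + 1 : ℝ) : ℂ) :=
    (isOpen_re_gt _).mem_nhds (show max r c < max r c + 1 by linarith)
  filter_upwards [hopen] with v hv
  exact hfg v ((le_max_left _ _).trans_lt hv) ((le_max_right _ _).trans_lt hv)

/-- A function on a right half plane which extends holomorphically to every half plane has an entire
extension. -/
theorem exists_entire_extension {f : ℂ → ℂ} {c : ℝ}
    (h : ∀ r : ℝ, ∃ g : ℂ → ℂ, DifferentiableOn ℂ g {w | r < w.re} ∧
      ∀ w : ℂ, r < w.re → c < w.re → g w = f w) :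
    ∃ g : ℂ → ℂ, Differentiable ℂ g ∧ ∀ w : ℂ, c < w.re → g w = f w := by
  choose g hg hgf using h
  have key : ∀ r r' : ℝ, ∀ w : ℂ, r < w.re → r' < w.re → g r w = g r' w := by
    intro r r' w hr hr'
    refine eqOn_of_eqOn_halfPlane (r := max r r') (c := c)
      ((hg r).mono fun v (hv : max r r' < v.re) => (le_max_left r r').trans_lt hv)
      ((hg r').mono fun v (hv : max r r' < v.re) => (le_max_right r r').trans_lt hv) (fun v hv hc => ?_) w
      (max_lt hr hr')
    rw [hgf r v ((le_max_left _ _).trans_lt hv) hc, hgf r' v ((le_max_right _ _).trans_lt hv) hc]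
  -- The extensions are glued by using at w the one on Re > Re w - 1; `key` says that the choice of
  -- half plane does not matter.
  refine ⟨fun w => g (w.re - 1) w, fun w => ?_, fun w hw => hgf _ w (by linarith) hw⟩
  have hmem : {v : ℂ | w.re - 1 < v.re} ∈ 𝓝 w := (isOpen_re_gt _).mem_nhds (by simp)
  refine ((hg (w.re - 1)).differentiableAt hmem).congr_of_eventuallyEq ?_
  filter_upwards [hmem] with v hv
  exact key _ _ v (by linarith) hv

variable {d : ℕ}

/-- The entire function `∏_{I_j ≠ 0} 1 / Γ(I_j λ - K_j + m_j + 1)`. -/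
def gammaFactor (I K m : Fin d → ℕ) (lam : ℂ) : ℂ :=
  ∏ j with I j ≠ 0, (Complex.Gamma (I j * lam - K j + m j + 1))⁻¹

theorem differentiable_gammaFactor (I K m : Fin d → ℕ) : Differentiable ℂ (gammaFactor I K m) := by
  unfold gammaFactor
  refine Differentiable.fun_finsetProd fun j _ => ?_
  exact Complex.differentiable_one_div_Gamma.comp
    (f := fun lam : ℂ => (I j : ℂ) * lam - K j + m j + 1) (by fun_prop)

/-- This is 1/Γ(s) = s/Γ(s + 1). The factor s is the divisor produced by one integration by parts in
z_j, so the two cancel. -/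
theorem gammaFactor_eq {I K m : Fin d → ℕ} {j : Fin d} (hj : I j ≠ 0) (lam : ℂ) :
    gammaFactor I K m lam =
      (I j * lam - K j + m j + 1) * gammaFactor I K (m + Pi.single j 1) lam := by
  have hmem : j ∈ Finset.univ.filter fun j => I j ≠ 0 := by simpa using hj
  rw [gammaFactor, gammaFactor, ← Finset.mul_prod_erase _ _ hmem, ← Finset.mul_prod_erase _ _ hmem,
    ← mul_assoc]
  congr 1
  · rw [Complex.one_div_Gamma_eq_self_mul_one_div_Gamma_add_one]
    simp [add_assoc]
  · refine Finset.prod_congr rfl fun i hi => ?_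
    simp [Pi.single_eq_of_ne (Finset.ne_of_mem_erase hi)]

/-- After multiplication by the gamma factor, the local zeta integral extends holomorphically to every
half plane. -/
theorem exists_extension_halfPlane {I K : Fin d → ℕ} {ψ : Cn d → ℂ} (hψ : ContDiff ℝ ∞ ψ)
    (hK : ∀ j, I j = 0 → K j = 0) {c : ℝ}
    (hc : ∀ lam : ℂ, c < lam.re → ∀ j, I j ≠ 0 → 1 < ((I j : ℂ) * lam - K j).re) {r : ℝ} {N : ℕ}
    (hN : ∀ lam : ℂ, r < lam.re → ∀ j, I j ≠ 0 → 0 ≤ 2 * (I j * lam.re - K j) + N) (n : ℕ) :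
    ∀ (m : Fin d → ℕ) (χ : Cn d → ℂ), ContDiff ℝ ∞ χ → HasCompactSupport χ →
      ∑ j with I j ≠ 0, (N - m j) = n →
      ∃ g : ℂ → ℂ, DifferentiableOn ℂ g {w | r < w.re} ∧
        ∀ w : ℂ, r < w.re → c < w.re → g w = gammaFactor I K m w * localZeta I K m ψ χ w := by
  -- The induction variable counts the integrations by parts still needed to raise every m_j with
  -- I_j ≠ 0 to at least N, where the integral converges on all of Re λ > r.
  induction n with
  | zero =>
    intro m χ hχ hχc hm
    refine ⟨fun w => gammaFactor I K m w * localZeta I K m ψ χ w, ?_, fun _ _ _ => rfl⟩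
    refine (differentiable_gammaFactor I K m).differentiableOn.mul
      (differentiableOn_localZeta hψ.continuous hχ.continuous hχc (isOpen_re_gt r) ?_)
    intro lam hlam j
    by_cases hj : I j = 0
    · simp [hj, hK j hj]
    · have h1 := (Finset.sum_eq_zero_iff.1 hm) j (by simpa using hj)
      have h2 : (N : ℝ) ≤ m j := by exact_mod_cast Nat.sub_eq_zero_iff_le.1 h1
      linarith [hN lam hlam j hj]
  | succ n ih =>
    intro m χ hχ hχc hm
    obtain ⟨j, hj, hjm⟩ : ∃ j, I j ≠ 0 ∧ N - m j ≠ 0 := by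
      by_contra! hcon
      rw [Finset.sum_eq_zero fun j hj => hcon j (by simpa using hj)] at hm
      omega
    have hmem : j ∈ Finset.univ.filter fun j => I j ≠ 0 := by simpa using hj
    have hm' : ∑ i with I i ≠ 0, (N - (m + Pi.single j 1 : Fin d → ℕ) i) = n := by
      rw [← Finset.add_sum_erase _ _ hmem] at hm ⊢
      have h1 : ∑ i ∈ (Finset.univ.filter fun j => I j ≠ 0).erase j,
          (N - (m + Pi.single j 1 : Fin d → ℕ) i) =
          ∑ i ∈ (Finset.univ.filter fun j => I j ≠ 0).erase j, (N - m i) :=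
        Finset.sum_congr rfl fun i hi => by
          simp [Pi.single_eq_of_ne (Finset.ne_of_mem_erase hi)]
      rw [h1]
      simp only [Pi.add_apply, Pi.single_eq_same]
      omega
    obtain ⟨g₁, hg₁, he₁⟩ := ih (m + Pi.single j 1) (wirtinger j χ) (contDiff_wirtinger hχ)
      (hasCompactSupport_wirtinger hχc) hm'
    obtain ⟨g₂, hg₂, he₂⟩ := ih (m + Pi.single j 1) (fun z => χ z * wirtinger j ψ z)
      (hχ.mul (contDiff_wirtinger hψ)) hχc.mul_right hm'
    refine ⟨fun w => -g₁ w - w * g₂ w, hg₁.neg.sub (differentiableOn_id.mul hg₂),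
      fun w hr hw => ?_⟩
    have := localZeta_integration_by_parts hψ hχ hχc hK (hc w hw) (m := m) hj
    beta_reduce
    rw [he₁ w hr hw, he₂ w hr hw, gammaFactor_eq (m := m) hj]
    linear_combination (-gammaFactor I K (m + Pi.single j 1) w) * this

/-- Meromorphic continuation of the local zeta integral. -/
theorem exists_meromorphic_localZeta {I K : Fin d → ℕ} (m : Fin d → ℕ) {ψ χ : Cn d → ℂ}
    (hψ : ContDiff ℝ ∞ ψ) (hχ : ContDiff ℝ ∞ χ) (hχc : HasCompactSupport χ)
    (hK : ∀ j, I j = 0 → K j = 0) {c : ℝ}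
    (hc : ∀ lam : ℂ, c < lam.re → ∀ j, I j ≠ 0 → 1 < ((I j : ℂ) * lam - K j).re) :
    ∃ G : ℂ → ℂ, Meromorphic G ∧ (∀ lam : ℂ, c < lam.re → G lam = localZeta I K m ψ χ lam) ∧
      ∀ a : ℂ, (∀ j, I j ≠ 0 → ∀ n : ℕ, (I j : ℂ) * a - K j + m j + 1 ≠ -n) → AnalyticAt ℂ G a := by
  obtain ⟨g, hg, hgf⟩ := exists_entire_extension (c := c)
    (f := fun w => gammaFactor I K m w * localZeta I K m ψ χ w) fun r => by
      -- Since Re λ > r ≥ -|r|, it suffices that N ≥ 2(I_j |r| + K_j) for each j; the sum over j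
      -- dominates each term.
      obtain ⟨N, hN⟩ := exists_nat_ge (∑ j, 2 * (I j * |r| + K j))
      refine exists_extension_halfPlane (N := N) hψ hK hc (fun lam hlam j _ => ?_) _ m χ hχ hχc rfl
      have h1 : 2 * (I j * |r| + K j) ≤ ∑ j, 2 * ((I j : ℝ) * |r| + K j) :=
        Finset.single_le_sum (f := fun j => 2 * ((I j : ℝ) * |r| + K j))
          (fun i _ => by positivity) (Finset.mem_univ j)
      have h2 : (I j : ℝ) * (-|r|) ≤ I j * lam.re :=
        mul_le_mul_of_nonneg_left ((neg_abs_le r).trans hlam.le) (Nat.cast_nonneg _)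
      linarith
  have hgA : ∀ a, AnalyticAt ℂ g a := fun a => hg.analyticAt a
  have hfA : ∀ a, AnalyticAt ℂ (gammaFactor I K m) a := fun a =>
    (differentiable_gammaFactor I K m).analyticAt a
  have hne : ∀ a : ℂ, (∀ j, I j ≠ 0 → ∀ n : ℕ, (I j : ℂ) * a - K j + m j + 1 ≠ -n) →
      gammaFactor I K m a ≠ 0 := fun a ha =>
    Finset.prod_ne_zero_iff.2 fun j hj => inv_ne_zero
      (Complex.Gamma_ne_zero (ha j (by simpa using hj)))
  refine ⟨fun w => g w * (gammaFactor I K m w)⁻¹, fun a => ?_, fun lam hlam => ?_, fun a ha => ?_⟩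
  · exact (hgA a).meromorphicAt.mul (hfA a).meromorphicAt.inv
  · beta_reduce
    rw [hgf lam hlam, mul_comm, inv_mul_cancel_left₀]
    -- For Re λ > c the arguments of Γ have positive real part, so they are not poles of Γ.
    refine hne lam fun j hj n h => ?_
    have h1 := congrArg Complex.re h
    have h2 := hc lam hlam j hj
    simp only [Complex.add_re, Complex.natCast_re, Complex.one_re, Complex.neg_re] at h1
    have : (0 : ℝ) ≤ n := Nat.cast_nonneg _
    have : (0 : ℝ) ≤ m j := Nat.cast_nonneg _
    linarith
  · exact (hgA a).mul ((hfA a).inv (hne a ha))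

/-- Conjugation in the coordinates `z_j` with `j ∉ A`. -/
def partialConj (A : Fin d → Prop) [DecidablePred A] (z : Cn d) : Cn d :=
  fun j => if A j then z j else (starRingEnd ℂ) (z j)

theorem contDiff_partialConj (A : Fin d → Prop) [DecidablePred A] :
    ContDiff ℝ ∞ (partialConj A) := by
  refine contDiff_pi.2 fun j => ?_
  unfold partialConj
  split_ifs
  · exact contDiff_apply ℝ ℂ j
  · exact Complex.conjCLE.contDiff.comp (contDiff_apply ℝ ℂ j)

theorem partialConj_involutive (A : Fin d → Prop) [DecidablePred A] :
    Function.Involutive (partialConj A) := by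
  intro z
  funext j
  simp only [partialConj]
  split_ifs <;> simp

/-- `partialConj` as a homeomorphism. -/
def partialConjHomeomorph (A : Fin d → Prop) [DecidablePred A] : Cn d ≃ₜ Cn d where
  toEquiv := (partialConj_involutive A).toPerm
  continuous_toFun := (contDiff_partialConj A).continuous
  continuous_invFun := (contDiff_partialConj A).continuous

theorem measurePreserving_partialConj (A : Fin d → Prop) [DecidablePred A] :
    MeasurePreserving (partialConj A) := by
  refine volume_preserving_pi (f := fun j x => if A j then x else (starRingEnd ℂ) x) fun j => ?_
  by_cases hA : A j
  · simp only [hA, if_true]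
    exact MeasurePreserving.id volume
  · simp only [hA, if_false]
    exact Complex.conjLIE.measurePreserving

/-- The integrand `|z^I e^ψ|^{2λ} z^{-J} \bar z^{-K} χ`. -/
def polarIntegrand (I J K : Fin d → ℕ) (ψ : Cn d → ℝ) (χ : Cn d → ℂ) (lam : ℂ) (z : Cn d) : ℂ :=
  ((‖monomial I z‖ * Real.exp (ψ z) : ℝ) : ℂ) ^ (2 * lam) *
    ((monomial J z * (starRingEnd ℂ) (monomial K z))⁻¹ * χ z)

/-- For ζ ≠ 0 the bases are positive reals, so their logarithms are real and no branch issue arises.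
At ζ = 0 both sides are 1 if i = 0 or λ = 0, and 0 otherwise. -/
theorem normSq_cpow_eq {ζ lam : ℂ} (i : ℕ) :
    (((‖ζ‖ ^ i : ℝ)) : ℂ) ^ (2 * lam) = ((Complex.normSq ζ : ℝ) : ℂ) ^ (i * lam) := by
  rcases eq_or_ne ζ 0 with rfl | hζ
  · rcases eq_or_ne i 0 with rfl | hi
    · simp
    · rcases eq_or_ne lam 0 with rfl | hl
      · simp
      · simp [hi, hl, Complex.zero_cpow]
  have h0 : (‖ζ‖ : ℂ) ≠ 0 := by simpa using hζ
  have hlog : ∀ k : ℕ, Complex.log ((‖ζ‖ ^ k : ℝ) : ℂ) = k * Complex.log ‖ζ‖ := fun k => by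
    rw [← Complex.ofReal_log (by positivity), Real.log_pow,
      ← Complex.ofReal_log (by positivity)]
    push_cast; ring
  rw [Complex.normSq_eq_norm_sq, Complex.cpow_def_of_ne_zero (by simp [hζ]),
    Complex.cpow_def_of_ne_zero (by simp [hζ]), hlog, hlog]
  congr 1
  push_cast
  ring

/-- With j ≤ k, ζ^{-j} \bar ζ^{-k} = |ζ|^{-2k} ζ^{k-j}: the larger order goes into the radial part
and a nonnegative power of ζ is left over. -/
theorem radialPow_eq_of_le {ζ lam : ℂ} (hζ : ζ ≠ 0) (i : ℕ) {j k : ℕ} (hjk : j ≤ k) :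
    radialPow (i * lam - k) (k - j) ζ =
      (((‖ζ‖ ^ i : ℝ)) : ℂ) ^ (2 * lam) * (ζ ^ j * (starRingEnd ℂ) ζ ^ k)⁻¹ := by
  have h1 : ((Complex.normSq ζ : ℝ) : ℂ) ≠ 0 := by simpa using hζ
  have h2 : (starRingEnd ℂ) ζ ≠ 0 := by simpa using hζ
  rw [normSq_cpow_eq, radialPow, Complex.cpow_sub _ _ h1, Complex.cpow_natCast,
    ← Complex.mul_conj, mul_pow, div_mul_eq_mul_div, div_eq_mul_inv, mul_assoc]
  congr 1
  obtain ⟨t, rfl⟩ := Nat.exists_eq_add_of_le hjk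
  rw [Nat.add_sub_cancel_left, pow_add]
  field_simp

/-- Conjugating the coordinates with J_j > K_j makes the antiholomorphic pole the stronger one in
every coordinate. Differentiation in z_j then always meets the smaller order min(J_j, K_j). -/
theorem polarIntegrand_partialConj {I J K : Fin d → ℕ} (ψ : Cn d → ℝ) (χ : Cn d → ℂ) (lam : ℂ)
    {z : Cn d} (hz : ∀ j, z j ≠ 0) :
    polarIntegrand I J K ψ χ lam (partialConj (fun j => J j ≤ K j) z) =
      localIntegrand I (fun j => max (J j) (K j))
        (fun j => max (J j) (K j) - min (J j) (K j))
        (fun z => ((2 * ψ (partialConj (fun j => J j ≤ K j) z) : ℝ) : ℂ))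
        (fun z => χ (partialConj (fun j => J j ≤ K j) z)) lam z := by
  set w := partialConj (fun j => J j ≤ K j) z with hw
  have hwn : ∀ j, ‖w j‖ = ‖z j‖ := fun j => by
    simp only [hw, partialConj]; split_ifs <;> simp
  rw [polarIntegrand, localIntegrand, ← hw]
  have hexp : (((Real.exp (ψ w) : ℝ)) : ℂ) ^ (2 * lam) =
      Complex.exp (lam * ((2 * ψ w : ℝ) : ℂ)) := by
    rw [Complex.ofReal_exp, ← Complex.ofReal_exp,
      Complex.cpow_def_of_ne_zero (by simp), ← Complex.ofReal_log (Real.exp_pos _).le,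
      Real.log_exp]
    congr 1; push_cast; ring
  have hmono : ((‖monomial I w‖ : ℝ) : ℂ) ^ (2 * lam) =
      ∏ j, (((‖z j‖ ^ I j : ℝ)) : ℂ) ^ (2 * lam) := by
    rw [monomial, norm_prod]
    simp only [norm_pow, hwn]
    have : ∀ s : Finset (Fin d), ((∏ j ∈ s, ‖z j‖ ^ I j : ℝ) : ℂ) ^ (2 * lam) =
        ∏ j ∈ s, (((‖z j‖ ^ I j : ℝ)) : ℂ) ^ (2 * lam) := fun s => by
      induction s using Finset.induction_on with
      | empty => simp
      | insert a s ha ih =>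
        rw [Finset.prod_insert ha, Finset.prod_insert ha, Complex.ofReal_mul,
          Complex.mul_cpow_ofReal_nonneg (by positivity)
            (Finset.prod_nonneg fun _ _ => by positivity), ih]
    exact this _
  have hden : (monomial J w * (starRingEnd ℂ) (monomial K w))⁻¹ =
      ∏ j, (w j ^ J j * (starRingEnd ℂ) (w j) ^ K j)⁻¹ := by
    rw [monomial, monomial, map_prod, ← Finset.prod_mul_distrib, Finset.prod_inv_distrib]
    simp
  have hweight : weight I (fun j => max (J j) (K j)) (fun j => max (J j) (K j) - min (J j) (K j))
      lam z = (∏ j, (((‖z j‖ ^ I j : ℝ)) : ℂ) ^ (2 * lam)) *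
        ∏ j, (w j ^ J j * (starRingEnd ℂ) (w j) ^ K j)⁻¹ := by
    rw [weight, ← Finset.prod_mul_distrib]
    refine Finset.prod_congr rfl fun j _ => ?_
    rcases le_or_gt (J j) (K j) with hjk | hjk
    · simp only [max_eq_right hjk, min_eq_left hjk]
      rw [radialPow_eq_of_le (hz j) _ hjk]
      simp [hw, partialConj, hjk]
    · simp only [max_eq_left hjk.le, min_eq_right hjk.le]
      rw [radialPow_eq_of_le (hz j) _ hjk.le]
      simp [hw, partialConj, hjk.not_ge, mul_comm]
  rw [Complex.ofReal_mul, Complex.mul_cpow_ofReal_nonneg (norm_nonneg _) (Real.exp_pos _).le,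
    hexp, hmono, hden, hweight]
  ring

/-- Meromorphic continuation of the integral of `|z^I e^ψ|^{2λ} z^{-J} \bar z^{-K} χ`. -/
theorem exists_meromorphic_polarIntegrand {I J K : Fin d → ℕ}
    (hJK : ∀ j, I j = 0 → J j = 0 ∧ K j = 0) {ψ : Cn d → ℝ} {χ : Cn d → ℂ}
    (hψ : ContDiff ℝ ∞ ψ) (hχ : ContDiff ℝ ∞ χ) (hχc : HasCompactSupport χ) :
    ∃ (G : ℂ → ℂ) (c : ℝ), Meromorphic G ∧
      (∀ lam : ℂ, c < lam.re → Integrable (polarIntegrand I J K ψ χ lam) ∧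
        G lam = ∫ z, polarIntegrand I J K ψ χ lam z) ∧
      ∀ a : ℂ, (∀ j, I j ≠ 0 → ∀ n : ℕ, (I j : ℂ) * a ≠ (min (J j) (K j) : ℕ) - 1 - n) →
        AnalyticAt ℂ G a := by
  set A : Fin d → Prop := fun j => J j ≤ K j with hA
  set M : Fin d → ℕ := fun j => max (J j) (K j) with hM
  set m : Fin d → ℕ := fun j => max (J j) (K j) - min (J j) (K j) with hm
  set ψ' : Cn d → ℂ := fun z => ((2 * ψ (partialConj A z) : ℝ) : ℂ) with hψ'
  set χ' : Cn d → ℂ := fun z => χ (partialConj A z) with hχ'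
  have hK : ∀ j, I j = 0 → M j = 0 := fun j hj => by simp [hM, hJK j hj]
  -- The threshold ∑ M_j + 1 works for every j at once, because I_j ≥ 1 gives I_j Re λ ≥ Re λ > M_j
  -- + 1.
  have hc : ∀ lam : ℂ, (∑ j, M j : ℕ) + 1 < lam.re → ∀ j, I j ≠ 0 →
      1 < ((I j : ℂ) * lam - M j).re := fun lam hlam j hj => by
    have h1 : (M j : ℝ) ≤ (∑ j, M j : ℕ) := by
      exact_mod_cast Finset.single_le_sum (fun _ _ => Nat.zero_le _) (Finset.mem_univ j)
    have h2 : (1 : ℝ) ≤ I j := by exact_mod_cast Nat.one_le_iff_ne_zero.2 hj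
    have h3 : (0 : ℝ) ≤ (∑ j, M j : ℕ) := Nat.cast_nonneg _
    have h4 : 1 * lam.re ≤ I j * lam.re := mul_le_mul_of_nonneg_right h2 (by linarith)
    simp only [Complex.sub_re, Complex.mul_re, Complex.natCast_re, Complex.natCast_im, zero_mul,
      sub_zero]
    linarith
  have hψs : ContDiff ℝ ∞ ψ' := Complex.ofRealCLM.contDiff.comp
    (contDiff_const.mul (hψ.comp (contDiff_partialConj A)))
  have hχs : ContDiff ℝ ∞ χ' := hχ.comp (contDiff_partialConj A)
  have hχcs : HasCompactSupport χ' :=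
    hχc.comp_isClosedEmbedding (partialConjHomeomorph A).isClosedEmbedding
  obtain ⟨G, hG, hGe, hGa⟩ := exists_meromorphic_localZeta m hψs hχs hχcs hK hc
  have hae : ∀ lam, (fun z => polarIntegrand I J K ψ χ lam (partialConj A z)) =ᵐ[volume]
      localIntegrand I M m ψ' χ' lam := fun lam => by
    filter_upwards [ae_coord_ne_zero] with z hz using polarIntegrand_partialConj ψ χ lam hz
  have hemb : MeasurableEmbedding (partialConj A) :=
    (partialConjHomeomorph A).isClosedEmbedding.measurableEmbedding
  refine ⟨G, (∑ j, M j : ℕ) + 1, hG, fun lam hlam => ⟨?_, ?_⟩, fun a ha => hGa a fun j hj n h => ha j hj n ?_⟩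
  · rw [← (measurePreserving_partialConj A).integrable_comp_emb hemb]
    refine (integrable_congr (hae lam)).2 (integrable_localIntegrand hψs.continuous hχs.continuous
      hχcs fun j => ?_)
    by_cases hj : I j = 0
    · simp [hj, hK j hj]
    · have := hc lam hlam j hj
      simp only [Complex.sub_re, Complex.mul_re, Complex.natCast_re, Complex.natCast_im, zero_mul,
        sub_zero] at this
      have h2 : (0 : ℝ) ≤ m j := Nat.cast_nonneg _
      linarith
  · rw [hGe lam hlam, ← (measurePreserving_partialConj A).integral_comp hemb, localZeta]
    exact (integral_congr_ae (hae lam)).symm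
  -- As M_j - m_j = min(J_j, K_j), the condition I_j a - M_j + m_j + 1 = -n reads I_j a = min(J_j,
  -- K_j) - 1 - n.
  · have h1 : M j = m j + min (J j) (K j) :=
      (Nat.sub_add_cancel (min_le_left _ _ |>.trans (le_max_left _ _))).symm
    rw [h1] at h
    push_cast at h ⊢
    linear_combination h

end Continuation

/-! ### The underlying real manifold and the change of coordinates for forms -/

section RealStructure

variable {d : ℕ} {X : Type*} [TopologicalSpace X] [ChartedSpace (Cn d) X]

theorem contDiffGroupoid_complex_le_real :
    contDiffGroupoid ω 𝓘(ℂ, Cn d) ≤ contDiffGroupoid ∞ 𝓘(ℝ, Cn d) := by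
  rw [contDiffGroupoid, contDiffGroupoid]
  apply groupoid_of_pregroupoid_le
  intro f s hfs
  exact (ContDiffOn.restrict_scalars ℝ (𝕜' := ℂ) hfs).of_le le_top

variable (d X) in
theorem isManifold_real [IsManifold 𝓘(ℂ, Cn d) ω X] : IsManifold 𝓘(ℝ, Cn d) ∞ X where
  compatible he he' := contDiffGroupoid_complex_le_real
    (StructureGroupoid.compatible (contDiffGroupoid ω 𝓘(ℂ, Cn d)) he he')

theorem mem_real_maximalAtlas {e : OpenPartialHomeomorph X (Cn d)} (he : e ∈ holCharts d X) :
    e ∈ IsManifold.maximalAtlas 𝓘(ℝ, Cn d) ∞ X := by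
  rw [holCharts, IsManifold.mem_maximalAtlas_iff, _root_.mem_maximalAtlas_iff] at he
  rw [IsManifold.mem_maximalAtlas_iff, _root_.mem_maximalAtlas_iff]
  exact fun e' he' => ⟨contDiffGroupoid_complex_le_real (he e' he').1,
    contDiffGroupoid_complex_le_real (he e' he').2⟩

theorem contDiffOn_coordChange {e e' : OpenPartialHomeomorph X (Cn d)} (he : e ∈ holCharts d X)
    (he' : e' ∈ holCharts d X) :
    ContDiffOn ℂ ω (e' ∘ e.symm) (e.target ∩ e.symm ⁻¹' e'.source) := by
  have h := contMDiffOn_of_mem_contDiffGroupoid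
    (IsManifold.compatible_of_mem_maximalAtlas (I := 𝓘(ℂ, Cn d)) he he')
  rw [contMDiffOn_iff_contDiffOn] at h
  simpa [OpenPartialHomeomorph.trans_source] using h

theorem isOpen_coordChange_source {Y : Type*} [TopologicalSpace Y]
    (e e' : OpenPartialHomeomorph Y (Cn d)) :
    IsOpen (e.target ∩ e.symm ⁻¹' e'.source) :=
  e.isOpen_inter_preimage_symm e'.open_source

theorem differentiableAt_coordChange {e e' : OpenPartialHomeomorph X (Cn d)}
    (he : e ∈ holCharts d X) (he' : e' ∈ holCharts d X) {z : Cn d}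
    (hz : z ∈ e.target ∩ e.symm ⁻¹' e'.source) : DifferentiableAt ℂ (e' ∘ e.symm) z :=
  ((contDiffOn_coordChange he he').contDiffAt
    ((isOpen_coordChange_source e e').mem_nhds hz)).differentiableAt (by simp)

/-- The real determinant of a complex-linear map is the squared modulus of its complex determinant.
Holomorphic charts are thus compatibly oriented, and the change of variables formula with |det|
applies to forms without a sign. -/
theorem det_fderiv_coordChange_nonneg {e e' : OpenPartialHomeomorph X (Cn d)}
    (he : e ∈ holCharts d X) (he' : e' ∈ holCharts d X) {z : Cn d}
    (hz : z ∈ e.target ∩ e.symm ⁻¹' e'.source) : 0 ≤ (fderiv ℝ (e' ∘ e.symm) z).det := by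
  rw [(differentiableAt_coordChange he he' hz).fderiv_restrictScalars ℝ]
  have h : ((fderiv ℂ (e' ∘ e.symm) z).restrictScalars ℝ).det =
      Algebra.norm ℝ (fderiv ℂ (e' ∘ e.symm) z).det := LinearMap.det_restrictScalars
  rw [h, Algebra.norm_complex_eq]
  exact Complex.normSq_nonneg _

theorem mdifferentiableAt_symm {e : OpenPartialHomeomorph X (Cn d)} (he : e ∈ holCharts d X)
    {z : Cn d} (hz : z ∈ e.target) : MDifferentiableAt 𝓘(ℝ, Cn d) 𝓘(ℝ, Cn d) e.symm z :=
  ((contMDiffOn_symm_of_mem_maximalAtlas (mem_real_maximalAtlas he)).contMDiffAt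
    (e.open_target.mem_nhds hz)).mdifferentiableAt (by simp)

/-- The value of a form on tangent vectors. -/
def CForm.eval {k : ℕ} (η : CForm d X k) (x : X) (v : Fin k → Cn d) : ℂ := η x v

theorem CForm.inChart_apply {k : ℕ} (η : CForm d X k) (e : OpenPartialHomeomorph X (Cn d))
    (z : Cn d) (v : Fin k → Cn d) :
    η.inChart e z v = η.eval (e.symm z)
      fun i => mfderiv 𝓘(ℝ, Cn d) 𝓘(ℝ, Cn d) e.symm z (v i) := rfl

/-- Near z one has e⁻¹ = e'⁻¹ ∘ (e' ∘ e⁻¹), and the chain rule applies. -/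
theorem CForm.inChart_coordChange {k : ℕ} (η : CForm d X k) {e e' : OpenPartialHomeomorph X (Cn d)}
    (he : e ∈ holCharts d X) (he' : e' ∈ holCharts d X) {z : Cn d}
    (hz : z ∈ e.target ∩ e.symm ⁻¹' e'.source) :
    η.inChart e z = (η.inChart e' ((e' ∘ e.symm) z)).compContinuousLinearMap
      (fderiv ℝ (e' ∘ e.symm) z) := by
  have hpt : e'.symm ((e' ∘ e.symm) z) = e.symm z := e'.left_inv hz.2
  have hloc : (e.symm : Cn d → X) =ᶠ[𝓝 z] e'.symm ∘ (e' ∘ e.symm) := by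
    filter_upwards [(isOpen_coordChange_source e e').mem_nhds hz] with w hw
    exact (e'.left_inv hw.2).symm
  have htgt : (e' ∘ e.symm) z ∈ e'.target := e'.map_source hz.2
  have hd : DifferentiableAt ℝ (e' ∘ e.symm) z :=
    (differentiableAt_coordChange he he' hz).restrictScalars ℝ
  have hder : ∀ v : Cn d, (mfderiv 𝓘(ℝ, Cn d) 𝓘(ℝ, Cn d) e.symm z v : Cn d) =
      mfderiv 𝓘(ℝ, Cn d) 𝓘(ℝ, Cn d) e'.symm ((e' ∘ e.symm) z)
        (fderiv ℝ (e' ∘ e.symm) z v) := by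
    intro v
    have h1 := hloc.mfderiv_eq (I := 𝓘(ℝ, Cn d)) (I' := 𝓘(ℝ, Cn d))
    have h2 := mfderiv_comp z (mdifferentiableAt_symm he' htgt) hd.mdifferentiableAt
    rw [mfderiv_eq_fderiv] at h2
    have h3 := h1.trans h2
    exact congrArg (fun T : Cn d →L[ℝ] Cn d => T v) h3
  ext v
  rw [ContinuousAlternatingMap.compContinuousLinearMap_apply, CForm.inChart_apply,
    CForm.inChart_apply, hpt]
  congr 1
  funext i
  exact hder (v i)

/-- The real and imaginary parts are real alternating forms of top degree, hence multiples of the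
determinant of a basis. -/
theorem alternatingMap_comp_det {M : Type*} [AddCommGroup M] [Module ℝ M] {n : ℕ}
    [FiniteDimensional ℝ M] (hn : Module.finrank ℝ M = n) (f : M [⋀^Fin n]→ₗ[ℝ] ℂ) (T : M →ₗ[ℝ] M)
    (v : Fin n → M) : f (fun i => T (v i)) = LinearMap.det T * f v := by
  let b := Module.finBasisOfFinrankEq ℝ M hn
  have key : ∀ g : M [⋀^Fin n]→ₗ[ℝ] ℝ, g (fun i => T (v i)) = LinearMap.det T * g v := fun g => by
    rw [g.eq_smul_basis_det b]
    simp only [AlternatingMap.smul_apply, smul_eq_mul]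
    have := b.det_comp T v
    rw [Function.comp_def] at this
    rw [this]
    ring
  apply Complex.ext
  · simpa using key (Complex.reLm.compAlternatingMap f)
  · simpa using key (Complex.imLm.compAlternatingMap f)

theorem finrank_real_Cn : Module.finrank ℝ (Cn d) = 2 * d := by
  rw [Module.finrank_pi_fintype]
  simp [Complex.finrank_real_complex, mul_comm]

theorem CForm.topCoeff_coordChange (η : CForm d X (2 * d)) {e e' : OpenPartialHomeomorph X (Cn d)}
    (he : e ∈ holCharts d X) (he' : e' ∈ holCharts d X) {z : Cn d}
    (hz : z ∈ e.target ∩ e.symm ⁻¹' e'.source) :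
    η.topCoeff e z = |(fderiv ℝ (e' ∘ e.symm) z).det| • η.topCoeff e' ((e' ∘ e.symm) z) := by
  rw [CForm.topCoeff, CForm.topCoeff, CForm.inChart_coordChange η he he' hz,
    abs_of_nonneg (det_fderiv_coordChange_nonneg he he' hz), Complex.real_smul]
  exact alternatingMap_comp_det finrank_real_Cn
    (η.inChart e' ((e' ∘ e.symm) z)).toAlternatingMap (fderiv ℝ (e' ∘ e.symm) z : Cn d →ₗ[ℝ] Cn d) _

end RealStructure

/-! ### Integration of top degree forms: computation in one chart, additivity, uniqueness -/

section Integral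

variable {d : ℕ} {X : Type*} [TopologicalSpace X] [ChartedSpace (Cn d) X]

theorem CForm.topCoeff_eq_zero {η : CForm d X (2 * d)} {e : OpenPartialHomeomorph X (Cn d)}
    {z : Cn d} (h : η (e.symm z) = 0) : η.topCoeff e z = 0 := by
  rw [CForm.topCoeff, CForm.inChart, h]
  rfl

theorem measurableSet_chart_disjointed {Y : Type*} [TopologicalSpace Y]
    (e : OpenPartialHomeomorph Y (Cn d)) (f : ℕ → OpenPartialHomeomorph Y (Cn d)) (n : ℕ) :
    MeasurableSet (e.target ∩ e.symm ⁻¹' disjointed (fun m => (f m).source) n) := by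
  refine disjointedRec (f := fun m => (f m).source)
    (p := fun S => MeasurableSet (e.target ∩ e.symm ⁻¹' S)) ?_ ?_
  · intro t i ht
    have : e.target ∩ e.symm ⁻¹' (t \ (f i).source) =
        (e.target ∩ e.symm ⁻¹' t) \ (e.target ∩ e.symm ⁻¹' (f i).source) := by
      ext z; simp only [mem_inter_iff, mem_preimage, Set.mem_sdiff]; tauto
    rw [this]
    exact ht.diff (isOpen_coordChange_source e (f i)).measurableSet
  · exact (isOpen_coordChange_source e (f n)).measurableSet

/-- A top degree form supported in a single chart domain can be integrated in that chart. -/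
theorem CForm.hasIntegral_of_chart {η : CForm d X (2 * d)} {e : OpenPartialHomeomorph X (Cn d)}
    (he : e ∈ holCharts d X) (hsupp : ∀ x ∉ e.source, η x = 0)
    (hint : IntegrableOn (η.topCoeff e) e.target) :
    η.HasIntegral (∫ z in e.target, η.topCoeff e z) := by
  intro f hf hcov piece
  set P : ℕ → Set X := disjointed fun m => (f m).source with hP
  have hPsub : ∀ n, P n ⊆ (f n).source := fun n => disjointed_le _ n
  have hPU : ⋃ n, P n = univ := by rw [hP, iUnion_disjointed, hcov]
  -- B n is the n-th piece of X seen in the chart e; A n is the same set, cut down to the domain of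
  -- e, seen in f n. The map e ∘ (f n)⁻¹ carries A n onto B n, the rest of `piece n` contributes 0,
  -- and the B n partition the target of e.
  set B : ℕ → Set (Cn d) := fun n => e.target ∩ e.symm ⁻¹' P n with hB
  set A : ℕ → Set (Cn d) := fun n => piece n ∩ ((f n).target ∩ (f n).symm ⁻¹' e.source) with hA
  have hBm : ∀ n, MeasurableSet (B n) := fun n => measurableSet_chart_disjointed e f n
  have hpm : ∀ n, MeasurableSet (piece n) := fun n => measurableSet_chart_disjointed (f n) f n
  have hAm : ∀ n, MeasurableSet (A n) := fun n =>
    (hpm n).inter (isOpen_coordChange_source (f n) e).measurableSet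
  have himg : ∀ n, (e ∘ (f n).symm) '' A n = B n := fun n => by
    ext w
    constructor
    · rintro ⟨z, ⟨⟨hz1, hz2⟩, -, hz3⟩, rfl⟩
      refine ⟨e.map_source hz3, ?_⟩
      simp only [mem_preimage, Function.comp_apply]
      rw [e.left_inv hz3]
      exact hz2
    · rintro ⟨hw1, hw2⟩
      have h1 : e.symm w ∈ (f n).source := hPsub n hw2
      refine ⟨f n (e.symm w), ⟨⟨(f n).map_source h1, ?_⟩, (f n).map_source h1, ?_⟩, ?_⟩
      · rw [mem_preimage, (f n).left_inv h1]; exact hw2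
      · rw [mem_preimage, (f n).left_inv h1]; exact e.map_target hw1
      · simp [(f n).left_inv h1, e.right_inv hw1]
  have hder : ∀ n, ∀ z ∈ A n, HasFDerivWithinAt (e ∘ (f n).symm)
      (fderiv ℝ (e ∘ (f n).symm) z) (A n) z := fun n z hz =>
    ((differentiableAt_coordChange (hf n) he hz.2).restrictScalars
      ℝ).hasFDerivAt.hasFDerivWithinAt
  have hinj : ∀ n, InjOn (e ∘ (f n).symm) (A n) := fun n z hz w hw hzw =>
    (f n).symm.injOn hz.2.1 hw.2.1 (e.injOn hz.2.2 hw.2.2 hzw)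
  have hcoef : ∀ n, EqOn ((f n : OpenPartialHomeomorph X (Cn d)) |> η.topCoeff)
      (fun z => |(fderiv ℝ (e ∘ (f n).symm) z).det| • η.topCoeff e ((e ∘ (f n).symm) z)) (A n) :=
    fun n z hz => η.topCoeff_coordChange (hf n) he hz.2
  have hzero : ∀ n, ∀ z ∈ piece n \ A n, η.topCoeff (f n) z = 0 := fun n z hz => by
    refine CForm.topCoeff_eq_zero (hsupp _ fun hmem => hz.2 ⟨hz.1, hz.1.1, hmem⟩)
  have hAi : ∀ n, IntegrableOn (η.topCoeff (f n)) (A n) := fun n => by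
    rw [integrableOn_congr_fun (hcoef n) (hAm n),
      ← integrableOn_image_iff_integrableOn_abs_det_fderiv_smul volume (hAm n) (hder n) (hinj n),
      himg]
    exact hint.mono_set inter_subset_left
  have hint_eq : ∀ n, ∫ z in piece n, η.topCoeff (f n) z = ∫ z in B n, η.topCoeff e z := fun n => by
    rw [setIntegral_eq_of_subset_of_forall_sdiff_eq_zero (hpm n) inter_subset_left (hzero n),
      setIntegral_congr_fun (hAm n) (hcoef n), ← himg n,
      integral_image_eq_integral_abs_det_fderiv_smul volume (hAm n) (hder n) (hinj n)]
  have hnorm_eq : ∀ n, ∫ z in piece n, ‖η.topCoeff (f n) z‖ = ∫ z in B n, ‖η.topCoeff e z‖ :=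
    fun n => by
    rw [setIntegral_eq_of_subset_of_forall_sdiff_eq_zero (hpm n) inter_subset_left
        (fun z hz => by rw [hzero n z hz, norm_zero]), ← himg n,
      integral_image_eq_integral_abs_det_fderiv_smul volume (hAm n) (hder n) (hinj n)]
    refine setIntegral_congr_fun (hAm n) fun z hz => ?_
    rw [show η.topCoeff (f n) z = _ from hcoef n hz, norm_smul, Real.norm_eq_abs, abs_abs,
      smul_eq_mul]
  have hBU : ⋃ n, B n = e.target := by
    rw [hB, ← inter_iUnion, ← preimage_iUnion, hPU, preimage_univ, inter_univ]
  have hBd : Pairwise (Function.onFun Disjoint B) := fun m n hmn =>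
    ((disjoint_disjointed _ hmn).preimage e.symm).mono inter_subset_right inter_subset_right
  refine ⟨fun n => (hAi n).of_forall_sdiff_eq_zero (hpm n) (hzero n), ?_, ?_⟩
  · simp only [hnorm_eq]
    exact (hasSum_integral_iUnion hBm hBd (by rw [hBU]; exact hint.norm)).summable
  · simp only [hint_eq]
    have := hasSum_integral_iUnion hBm hBd (f := η.topCoeff e) (by rw [hBU]; exact hint)
    rwa [hBU] at this

theorem CForm.HasIntegral.add {η θ : CForm d X (2 * d)} {a b : ℂ} (hη : η.HasIntegral a)
    (hθ : θ.HasIntegral b) : (η + θ).HasIntegral (a + b) := by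
  intro f hf hcov piece
  obtain ⟨h1, h2, h3⟩ := hη f hf hcov
  obtain ⟨k1, k2, k3⟩ := hθ f hf hcov
  refine ⟨fun n => (h1 n).add (k1 n), ?_, ?_⟩
  · refine (h2.add k2).of_nonneg_of_le (fun n => integral_nonneg fun _ => norm_nonneg _) fun n => ?_
    rw [← integral_add (h1 n).norm (k1 n).norm]
    exact integral_mono ((h1 n).add (k1 n)).norm ((h1 n).norm.add (k1 n).norm)
      fun z => norm_add_le _ _
  · refine (h3.add k3).congr_fun fun n => ?_
    exact integral_add (h1 n) (k1 n)

theorem CForm.hasIntegral_zero : (0 : CForm d X (2 * d)).HasIntegral 0 := by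
  intro f hf hcov piece
  have h : ∀ n z, (0 : CForm d X (2 * d)).topCoeff (f n) z = 0 := fun n z =>
    CForm.topCoeff_eq_zero rfl
  have h' : ∀ n, (0 : CForm d X (2 * d)).topCoeff (f n) = 0 := fun n => funext (h n)
  simp only [h']
  exact ⟨fun n => integrableOn_zero, by simp, by simp⟩

theorem CForm.HasIntegral.sum {ι : Type*} (t : Finset ι) {η : ι → CForm d X (2 * d)} {a : ι → ℂ}
    (h : ∀ i ∈ t, (η i).HasIntegral (a i)) : (∑ i ∈ t, η i).HasIntegral (∑ i ∈ t, a i) := by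
  classical
  induction t using Finset.induction_on with
  | empty => simpa using CForm.hasIntegral_zero
  | insert i t hi ih =>
    rw [Finset.sum_insert hi, Finset.sum_insert hi]
    exact (h i (Finset.mem_insert_self _ _)).add
      (ih fun j hj => h j (Finset.mem_insert_of_mem hj))

variable [SecondCountableTopology X] [IsManifold 𝓘(ℂ, Cn d) ω X]

variable (d X) in
theorem exists_countable_chart_cover [Nonempty X] : ∃ f : ℕ → OpenPartialHomeomorph X (Cn d),
    (∀ n, f n ∈ holCharts d X) ∧ (⋃ n, (f n).source) = univ := by
  obtain ⟨s, hs, hcov⟩ := TopologicalSpace.countable_cover_nhds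
    (fun x : X => (chartAt (Cn d) x).open_source.mem_nhds (mem_chart_source (Cn d) x))
  have hne : s.Nonempty := by
    obtain ⟨x⟩ := ‹Nonempty X›
    have hx : x ∈ ⋃ x ∈ s, (chartAt (Cn d) x).source := hcov ▸ mem_univ x
    simp only [mem_iUnion] at hx
    exact ⟨hx.choose, hx.choose_spec.choose⟩
  obtain ⟨g, rfl⟩ := hs.exists_eq_range hne
  refine ⟨fun n => chartAt (Cn d) (g n), fun n => IsManifold.chart_mem_maximalAtlas _, ?_⟩
  simpa using hcov

/-- `HasIntegral` quantifies over all countable covers by holomorphic charts, so the value is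
determined as soon as one such cover exists; second countability provides it. -/
theorem CForm.HasIntegral.unique [Nonempty X] {η : CForm d X (2 * d)} {a b : ℂ}
    (ha : η.HasIntegral a) (hb : η.HasIntegral b) : a = b := by
  obtain ⟨f, hf, hcov⟩ := exists_countable_chart_cover d X
  exact (ha f hf hcov).2.2.unique (hb f hf hcov).2.2

theorem CForm.HasIntegral.integral_eq [Nonempty X] {η : CForm d X (2 * d)} {a : ℂ}
    (ha : η.HasIntegral a) : η.integral = a := by
  have h : η.IsIntegrable := ⟨a, ha⟩
  rw [CForm.integral, dif_pos h]
  exact h.choose_spec.unique ha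

end Integral

/-! ### Exterior products: pullback, linearity, smoothness -/

section WedgeFormulas

variable {M : Type*} [AddCommGroup M] [Module ℝ M] [TopologicalSpace M]

/-- The shuffle sum for the exterior product, over chosen representatives of the shuffles. -/
theorem wedge_apply {k l n : ℕ} (h : k + l = n) (a : M [⋀^Fin k]→L[ℝ] ℂ) (b : M [⋀^Fin l]→L[ℝ] ℂ)
    (v : Fin n → M) :
    wedge h a b v = ∑ q : Equiv.Perm.ModSumCongr (Fin k) (Fin l),
      ((Equiv.Perm.sign q.out : ℤ) : ℂ) *
        (a (fun i => v (finCongr h (finSumFinEquiv (q.out (Sum.inl i))))) *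
          b (fun i => v (finCongr h (finSumFinEquiv (q.out (Sum.inr i)))))) := by
  change wedgeAux h a.toAlternatingMap b.toAlternatingMap v = _
  simp only [wedgeAux, AlternatingMap.domDomCongr_apply, LinearMap.compAlternatingMap_apply,
    AlternatingMap.domCoprod_apply, sum_apply, map_sum]
  refine Finset.sum_congr rfl fun q _ => ?_
  -- The summand is defined on a quotient; writing q as the class of `q.out` makes it an explicit
  -- product.
  have hq : AlternatingMap.domCoprod.summand a.toAlternatingMap b.toAlternatingMap q =
      AlternatingMap.domCoprod.summand a.toAlternatingMap b.toAlternatingMap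
        (Quotient.mk'' q.out) := by
    congr 1
    exact (Quotient.out_eq' q).symm
  rw [hq, AlternatingMap.domCoprod.summand_mk'']
  rcases Int.units_eq_one_or (Equiv.Perm.sign q.out) with hs | hs <;> simp [hs]

theorem wedge_compContinuousLinearMap {M' : Type*} [AddCommGroup M'] [Module ℝ M']
    [TopologicalSpace M'] {k l n : ℕ} (h : k + l = n) (a : M [⋀^Fin k]→L[ℝ] ℂ)
    (b : M [⋀^Fin l]→L[ℝ] ℂ) (T : M' →L[ℝ] M) :
    (wedge h a b).compContinuousLinearMap T =
      wedge h (a.compContinuousLinearMap T) (b.compContinuousLinearMap T) := by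
  ext v
  simp only [ContinuousAlternatingMap.compContinuousLinearMap_apply, wedge_apply,
    Function.comp_def]

theorem wedge_smul_left {k l n : ℕ} (h : k + l = n) (c : ℂ) (a : M [⋀^Fin k]→L[ℝ] ℂ)
    (b : M [⋀^Fin l]→L[ℝ] ℂ) : wedge h (c • a) b = c • wedge h a b := by
  ext v
  simp only [wedge_apply, ContinuousAlternatingMap.smul_apply, smul_eq_mul, Finset.mul_sum]
  refine Finset.sum_congr rfl fun q _ => ?_
  ring

theorem wedge_zero {k l n : ℕ} (h : k + l = n) (a : M [⋀^Fin k]→L[ℝ] ℂ) :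
    wedge h a (0 : M [⋀^Fin l]→L[ℝ] ℂ) = 0 := by
  ext v
  simp [wedge_apply]

theorem contDiffOn_wedge_apply {E F : Type*} [NormedAddCommGroup E] [NormedSpace ℝ E]
    [NormedAddCommGroup F] [NormedSpace ℝ F] {k l n : ℕ} (h : k + l = n)
    {a : E → F [⋀^Fin k]→L[ℝ] ℂ} {b : E → F [⋀^Fin l]→L[ℝ] ℂ} {W : Set E}
    (ha : ContDiffOn ℝ ∞ a W) (hb : ContDiffOn ℝ ∞ b W) (v : Fin n → F) :
    ContDiffOn ℝ ∞ (fun z => wedge h (a z) (b z) v) W := by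
  simp only [wedge_apply]
  refine ContDiffOn.sum fun q _ => contDiffOn_const.mul (ContDiffOn.mul ?_ ?_)
  · exact (ContinuousAlternatingMap.apply ℝ F ℂ _).contDiff.comp_contDiffOn ha
  · exact (ContinuousAlternatingMap.apply ℝ F ℂ _).contDiff.comp_contDiffOn hb

end WedgeFormulas

/-! ### Smooth cut-off and extension from open subsets -/

section Extension

variable {E F : Type*} [NormedAddCommGroup E] [NormedSpace ℝ E] [NormedAddCommGroup F]
  [NormedSpace ℝ F]

/-- Extension by zero of a function which is smooth on an open set and vanishes off a compact
subset. -/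
theorem contDiff_indicator_of_eq_zero {f : E → F} {W C : Set E} (hW : IsOpen W) (hC : IsCompact C)
    (hCW : C ⊆ W) (hf : ContDiffOn ℝ ∞ f W) (h0 : ∀ z ∈ W, z ∉ C → f z = 0) :
    ContDiff ℝ ∞ (W.indicator f) ∧ HasCompactSupport (W.indicator f) := by
  have hz : ∀ z ∉ C, W.indicator f z = 0 := fun z hz => by
    by_cases hw : z ∈ W
    · rw [indicator_of_mem hw, h0 z hw hz]
    · rw [indicator_of_notMem hw]
  refine ⟨contDiff_iff_contDiffAt.2 fun z => ?_, HasCompactSupport.intro hC hz⟩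
  by_cases hw : z ∈ W
  · refine (hf.contDiffAt (hW.mem_nhds hw)).congr_of_eventuallyEq ?_
    filter_upwards [hW.mem_nhds hw] with w hw
    rw [indicator_of_mem hw]
  · refine (contDiffAt_const (c := 0)).congr_of_eventuallyEq ?_
    filter_upwards [hC.isClosed.isOpen_compl.mem_nhds fun h => hw (hCW h)] with w hw
    exact hz w hw

/-- A function which is smooth near a compact set coincides there with a globally smooth function. -/
theorem exists_contDiff_eqOn [FiniteDimensional ℝ E] {f : E → ℝ} {W C : Set E} (hW : IsOpen W)
    (hC : IsCompact C) (hCW : C ⊆ W) (hf : ContDiffOn ℝ ∞ f W) :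
    ∃ g : E → ℝ, ContDiff ℝ ∞ g ∧ EqOn g f C := by
  obtain ⟨L, hL, hCL, hLW⟩ := exists_compact_between hC hW hCW
  obtain ⟨θ, hθ, -, hθs, hθ1⟩ := exists_contMDiff_support_eq_eq_one_iff (n := ⊤) 𝓘(ℝ, E)
    isOpen_interior hC.isClosed hCL
  have hθ' : ContDiff ℝ ∞ θ := hθ.contDiff
  refine ⟨W.indicator fun z => θ z * f z, (contDiff_indicator_of_eq_zero hW hL hLW
    (hθ'.contDiffOn.mul hf) fun z _ hz => ?_).1, fun z hz => ?_⟩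
  · have : z ∉ Function.support θ := fun h => hz (interior_subset (hθs ▸ h))
    rw [Function.notMem_support.1 this, zero_mul]
  · rw [indicator_of_mem (hCW hz), (hθ1 z).1 hz, one_mul]

end Extension

/-! ### The hermitian metric in a local frame -/

section Metric

variable {d : ℕ} {X : Type*} [TopologicalSpace X] [ChartedSpace (Cn d) X]
  {L : X → Type*} [TopologicalSpace (TotalSpace ℂ L)] [∀ x, AddCommGroup (L x)]
  [∀ x, Module ℂ (L x)] [∀ x, TopologicalSpace (L x)] [FiberBundle ℂ L]

theorem LineBundleMetric.norm_zero (h : LineBundleMetric d L) (x : X) : h.norm x 0 = 0 := by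
  simpa using h.norm_smul x 0 0

variable [VectorBundle ℂ ℂ L]

theorem LineBundleMetric.frame_pos (h : LineBundleMetric d L) {x y : X}
    (hy : y ∈ (trivializationAt ℂ L x).baseSet) :
    0 < h.norm y ((trivializationAt ℂ L x).symm y 1) := by
  refine h.norm_pos _ _ fun h0 => ?_
  have h1 := (trivializationAt ℂ L x).apply_mk_symm hy (1 : ℂ)
  have h2 := ((trivializationAt ℂ L x).linear ℂ hy).map_zero
  rw [h0] at h1
  rw [h1] at h2
  exact one_ne_zero h2

/-- The fibre is a line spanned by the frame vector, so v is its coordinate times that vector and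
homogeneity of the norm applies. -/
theorem LineBundleMetric.norm_eq (h : LineBundleMetric d L) {x y : X}
    (hy : y ∈ (trivializationAt ℂ L x).baseSet) (v : L y) :
    h.norm y v = ‖(trivializationAt ℂ L x ⟨y, v⟩).2‖ *
      h.norm y ((trivializationAt ℂ L x).symm y 1) := by
  rw [← h.norm_smul]
  congr 1
  have h1 := (trivializationAt ℂ L x).symm_apply_apply_mk hy v
  rw [← Trivialization.symmₗ_apply (R := ℂ) _ hy] at h1 ⊢
  rw [← map_smul, smul_eq_mul, mul_one, h1]

theorem trivialization_eq_zero_iff {x y : X} (hy : y ∈ (trivializationAt ℂ L x).baseSet) (v : L y) :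
    (trivializationAt ℂ L x ⟨y, v⟩).2 = 0 ↔ v = 0 := by
  constructor
  · intro h0
    have h1 := (trivializationAt ℂ L x).symm_apply_apply_mk hy v
    rw [h0, ← Trivialization.symmₗ_apply (R := ℂ) _ hy, map_zero] at h1
    exact h1.symm
  · rintro rfl
    exact ((trivializationAt ℂ L x).linear ℂ hy).map_zero

end Metric

/-! ### Continuation of the contribution of one coordinate neighbourhood -/

section LocalContinuation

variable {d : ℕ} {X : Type*} [TopologicalSpace X] [ChartedSpace (Cn d) X]

theorem monomial_ne_zero_of_support_le {I J : Fin d → ℕ} (hIJ : ∀ j, I j = 0 → J j = 0) {z : Cn d}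
    (hz : monomial I z ≠ 0) : monomial J z ≠ 0 := by
  rw [monomial, Finset.prod_ne_zero_iff] at hz ⊢
  intro j hj
  by_cases h0 : J j = 0
  · simp [h0]
  · have hI : I j ≠ 0 := fun h => h0 (hIJ j h)
    exact pow_ne_zero _ fun hzj => hz j hj (by rw [hzj, zero_pow hI])

theorem CForm.SmoothOn.mono {k : ℕ} {η : CForm d X k} {U V : Set X} (hη : η.SmoothOn U)
    (hVU : V ⊆ U) : η.SmoothOn V := fun e he =>
  (hη e he).mono fun _ hz => ⟨hz.1, hVU hz.2⟩

variable {L : X → Type*} [TopologicalSpace (TotalSpace ℂ L)] [∀ x, AddCommGroup (L x)]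
  [∀ x, Module ℂ (L x)] [∀ x, TopologicalSpace (L x)] [FiberBundle ℂ L]

theorem topCoeff_regularizedForm {k l : ℕ} (hkl : k + l = 2 * d) (h : LineBundleMetric d L)
    (s : ∀ x, L x) (α : CForm d X k) (ξ : CForm d X l) (lam : ℂ) (ρ : X → ℝ)
    (e : OpenPartialHomeomorph X (Cn d)) (z : Cn d) :
    CForm.topCoeff (fun y => (ρ y : ℂ) • regularizedForm hkl h s α ξ lam y) e z =
      (ρ (e.symm z) : ℂ) * ((h.norm (e.symm z) (s (e.symm z)) : ℂ) ^ (2 * lam) *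
        wedge hkl (α.inChart e z) (ξ.inChart e z) (stdFrame d)) := by
  have h1 := wedge_compContinuousLinearMap hkl (α (e.symm z)) (ξ (e.symm z))
    (mfderiv 𝓘(ℝ, Cn d) 𝓘(ℝ, Cn d) e.symm z)
  have h2 : wedge hkl (α (e.symm z)) (ξ (e.symm z))
      (fun i => mfderiv 𝓘(ℝ, Cn d) 𝓘(ℝ, Cn d) e.symm z (stdFrame d i)) =
      wedge hkl (α.inChart e z) (ξ.inChart e z) (stdFrame d) :=
    congrArg (fun w : (Cn d) [⋀^Fin (2 * d)]→L[ℝ] ℂ => w (stdFrame d)) h1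
  rw [← h2]
  rfl

variable [VectorBundle ℂ ℂ L]

theorem contDiffOn_of_holomorphic {φ : X → ℂ} {V : Set X}
    (hφ : ∀ y ∈ V, HolomorphicNear (d := d) φ y) {e : OpenPartialHomeomorph X (Cn d)}
    (he : e ∈ holCharts d X) : ContDiffOn ℝ ∞ (φ ∘ e.symm) (e.target ∩ e.symm ⁻¹' V) := by
  intro z hz
  have h1 : ContMDiffAt 𝓘(ℂ, Cn d) 𝓘(ℂ, Cn d) ω e.symm z :=
    (contMDiffOn_symm_of_mem_maximalAtlas he).contMDiffAt (e.open_target.mem_nhds hz.1)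
  have h2 : ContMDiffAt 𝓘(ℂ, Cn d) 𝓘(ℂ) ω (φ ∘ e.symm) z := (hφ _ hz.2).comp z h1
  exact ((h2.contDiffAt.restrict_scalars ℝ).of_le le_top).contDiffWithinAt

theorem contDiffOn_of_contMDiffOn_real {N : X → ℝ} {V : Set X}
    (hN : ContMDiffOn 𝓘(ℝ, Cn d) 𝓘(ℝ, ℝ) ∞ N V) {e : OpenPartialHomeomorph X (Cn d)}
    (he : e ∈ holCharts d X) : ContDiffOn ℝ ∞ (N ∘ e.symm) (e.target ∩ e.symm ⁻¹' V) := by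
  have h1 := contMDiffOn_symm_of_mem_maximalAtlas (mem_real_maximalAtlas he)
  exact (hN.comp (h1.mono inter_subset_left) fun z hz => hz.2).contDiffOn

/-- Near `x`, in the coordinates `e`, one has `|s| = |z^I| e^ψ` with `ψ` smooth, and
`z^J \bar z^K α` is smooth. -/
theorem IsLocalData.exists_nhds [IsManifold 𝓘(ℂ, Cn d) ω X] (h : LineBundleMetric d L)
    {s : ∀ x, L x} {k : ℕ} {α : CForm d X k} {x : X} {e : OpenPartialHomeomorph X (Cn d)}
    {I J K : Fin d → ℕ} (hloc : IsLocalData s α x e I J K) :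
    ∃ (V : Set X) (α' : CForm d X k) (ψ : Cn d → ℝ), IsOpen V ∧ x ∈ V ∧ V ⊆ e.source ∧
      α'.SmoothOn V ∧ ContDiffOn ℝ ∞ ψ (e.target ∩ e.symm ⁻¹' V) ∧
      (∀ y ∈ V, h.norm y (s y) = ‖monomial I (e y)‖ * Real.exp (ψ (e y))) ∧
      (∀ y ∈ V, s y = 0 ↔ monomial I (e y) = 0) ∧
      ∀ y ∈ V, s y ≠ 0 →
        (monomial J (e y) * (starRingEnd ℂ) (monomial K (e y))) • α y = α' y := by
  obtain ⟨he, hxe, -, ⟨φ, hφ, hφx, hφs⟩, ⟨hmin, -⟩⟩ := hloc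
  obtain ⟨-, U, hU, hxU, hUe, α', hα', hαα'⟩ := hmin
  set B := (trivializationAt ℂ L x).baseSet with hB
  have hBo : IsOpen B := (trivializationAt ℂ L x).open_baseSet
  have hev : ∀ᶠ y in 𝓝 x, HolomorphicNear (d := d) φ y ∧ φ y ≠ 0 ∧
      (trivializationAt ℂ L x ⟨y, s y⟩).2 = monomial I (e y) * φ y ∧ y ∈ U ∧ y ∈ B := by
    refine ((contMDiffAt_iff_contMDiffAt_nhds (by simp)).1 hφ).and
      ((hφ.continuousAt.eventually_ne hφx).and (hφs.and ((hU.eventually_mem hxU).and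
        (hBo.eventually_mem (FiberBundle.mem_baseSet_trivializationAt' x)))))
  obtain ⟨V, hV, hVo, hxV⟩ := eventually_nhds_iff.1 hev
  have hVe : V ⊆ e.source := fun y hy => hUe (hV y hy).2.2.2.1
  set N : X → ℝ := fun y => h.norm y ((trivializationAt ℂ L x).symm y 1) with hN
  have hNpos : ∀ y ∈ V, 0 < N y := fun y hy => h.frame_pos (hV y hy).2.2.2.2
  have hφpos : ∀ y ∈ V, 0 < ‖φ y‖ := fun y hy => norm_pos_iff.2 (hV y hy).2.1
  -- In the frame |s| = |z^I| |φ| N with N the norm of the frame vector, hence ψ = log |φ| + log N,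
  -- which is smooth because φ does not vanish on V.
  refine ⟨V, α', fun z => Real.log ‖φ (e.symm z)‖ + Real.log (N (e.symm z)), hVo, hxV, hVe,
    hα'.mono fun y hy => (hV y hy).2.2.2.1, ?_, fun y hy => ?_, fun y hy => ?_, fun y hy hsy => ?_⟩
  · have h1 := contDiffOn_of_holomorphic (fun y hy => (hV y hy).1) he
    have h2 := contDiffOn_of_contMDiffOn_real
      ((h.smooth x).mono fun y hy => (hV y hy).2.2.2.2) he (V := V)
    refine ContDiffOn.add (ContDiffOn.log (h1.norm ℝ fun z hz => (hV _ hz.2).2.1) fun z hz => ?_)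
      (h2.log fun z hz => (hNpos _ hz.2).ne')
    exact (hφpos _ hz.2).ne'
  · beta_reduce
    rw [e.left_inv (hVe hy), Real.exp_add, Real.exp_log (hφpos y hy), Real.exp_log (hNpos y hy),
      h.norm_eq (hV y hy).2.2.2.2, (hV y hy).2.2.1, norm_mul, mul_assoc]
  · rw [← trivialization_eq_zero_iff (hV y hy).2.2.2.2, (hV y hy).2.2.1, mul_eq_zero,
      or_iff_left (hV y hy).2.1]
  · exact hαα' y ⟨(hV y hy).2.2.2.1, hsy⟩

/-- The contribution of a coordinate neighbourhood to the regularized integral has a meromorphic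
continuation, whose poles are controlled by the local data. -/
theorem IsLocalData.exists_continuation [IsManifold 𝓘(ℂ, Cn d) ω X] [T2Space X]
    (h : LineBundleMetric d L)
    {s : ∀ x, L x} {k l : ℕ} (hkl : k + l = 2 * d) {α : CForm d X k} {ξ : CForm d X l}
    (hξ : ξ.SmoothOn univ) (hξc : IsCompact ξ.support) {x : X}
    {e : OpenPartialHomeomorph X (Cn d)} {I J K : Fin d → ℕ} (hloc : IsLocalData s α x e I J K) :
    ∃ V : Set X, IsOpen V ∧ x ∈ V ∧ ∀ ρ : X → ℝ, ContMDiff 𝓘(ℝ, Cn d) 𝓘(ℝ, ℝ) ∞ ρ → tsupport ρ ⊆ V →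
      ∃ (G : ℂ → ℂ) (c : ℝ), Meromorphic G ∧
        (∀ lam : ℂ, c < lam.re → CForm.HasIntegral
          (fun y => (ρ y : ℂ) • regularizedForm hkl h s α ξ lam y) (G lam)) ∧
        ∀ a : ℂ, (∀ j, I j ≠ 0 → ∀ n : ℕ, (I j : ℂ) * a ≠ (min (J j) (K j) : ℕ) - 1 - n) →
          AnalyticAt ℂ G a := by
  obtain ⟨V, α', ψ₀, hV, hxV, hVe, hα', hψ₀, hnorm, hzero, hαα'⟩ := hloc.exists_nhds h
  have he : e ∈ holCharts d X := hloc.1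
  have hJK : ∀ j, I j = 0 → J j = 0 ∧ K j = 0 := hloc.2.2.2.2.1.1
  refine ⟨V, hV, hxV, fun ρ hρ hρV => ?_⟩
  set W := e.target ∩ e.symm ⁻¹' V with hW
  have hWo : IsOpen W := e.isOpen_inter_preimage_symm hV
  set C := e '' (tsupport ρ ∩ ξ.support) with hC
  have hcpt : IsCompact (tsupport ρ ∩ ξ.support) :=
    hξc.inter_left (isClosed_tsupport ρ)
  have hCc : IsCompact C :=
    hcpt.image_of_continuousOn (e.continuousOn.mono fun y hy => hVe (hρV hy.1))
  have hCW : C ⊆ W := by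
    rintro _ ⟨y, hy, rfl⟩
    have hyV := hρV hy.1
    refine ⟨e.map_source (hVe hyV), ?_⟩
    rwa [mem_preimage, e.left_inv (hVe hyV)]
  have hoff : ∀ z ∈ e.target, z ∉ C → ρ (e.symm z) = 0 ∨ ξ (e.symm z) = 0 := by
    intro z hz hzC
    by_contra! hcon
    exact hzC ⟨e.symm z, ⟨subset_tsupport _ hcon.1, subset_closure hcon.2⟩, e.right_inv hz⟩
  set χ₀ : Cn d → ℂ := fun z => (ρ (e.symm z) : ℂ) *
    wedge hkl (α'.inChart e z) (ξ.inChart e z) (stdFrame d) with hχ₀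
  have hχ₀s : ContDiffOn ℝ ∞ χ₀ W := by
    have h1 := contDiffOn_of_contMDiffOn_real (hρ.contMDiffOn (s := V)) he
    have h2 := contDiffOn_wedge_apply hkl (hα' e he)
      ((hξ e he).mono fun z hz => ⟨hz.1, mem_univ _⟩) (stdFrame d)
    exact (Complex.ofRealCLM.contDiff.comp_contDiffOn h1).mul h2
  have hχ₀0 : ∀ z ∈ W, z ∉ C → χ₀ z = 0 := fun z hz hzC => by
    rcases hoff z hz.1 hzC with h0 | h0
    · simp [hχ₀, h0]
    · have : ξ.inChart e z = 0 := by rw [CForm.inChart, h0]; rfl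
      simp [hχ₀, this, wedge_zero]
  obtain ⟨hχ, hχc⟩ := contDiff_indicator_of_eq_zero hWo hCc hCW hχ₀s hχ₀0
  -- The local ψ₀ may be replaced by a global smooth function agreeing with it on C, since the
  -- amplitude vanishes off C.
  obtain ⟨ψ, hψ, hψe⟩ := exists_contDiff_eqOn hWo hCc hCW hψ₀
  set χ := W.indicator χ₀ with hχdef
  have hχC : ∀ z ∉ C, χ z = 0 := fun z hz => by
    by_cases hw : z ∈ W
    · rw [hχdef, indicator_of_mem hw, hχ₀0 z hw hz]
    · rw [hχdef, indicator_of_notMem hw]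
  obtain ⟨G, c, hG, hGi, hGa⟩ := exists_meromorphic_polarIntegrand hJK hψ hχ hχc
  -- Taking Re λ > 0 ensures λ ≠ 0, so that 0^{2λ} = 0 and both integrands vanish on D, where α is
  -- not controlled by α'.
  refine ⟨G, max c 0, hG, fun lam hlam => ?_, hGa⟩
  have hlam0 : (2 : ℂ) * lam ≠ 0 := by
    intro h0
    have hl : lam = 0 := by simpa using h0
    rw [hl] at hlam
    simp at hlam
  obtain ⟨hint, hGeq⟩ := hGi lam ((le_max_left _ _).trans_lt hlam)
  set η : CForm d X (2 * d) := fun y => (ρ y : ℂ) • regularizedForm hkl h s α ξ lam y with hη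
  have hcoef : EqOn (η.topCoeff e) (polarIntegrand I J K ψ χ lam) e.target := by
    intro z hz
    rw [hη, topCoeff_regularizedForm]
    by_cases hzC : z ∈ C
    · have hzW := hCW hzC
      have hyV : e.symm z ∈ V := hzW.2
      have hright : e (e.symm z) = z := e.right_inv hz
      have hn := hnorm _ hyV
      rw [hright, ← hψe hzC] at hn
      rw [polarIntegrand, hχdef, indicator_of_mem hzW, hn, hχ₀]
      by_cases hI : monomial I z = 0
      · simp [hI, hlam0]
      · have hsy : s (e.symm z) ≠ 0 := fun h0 => hI (by simpa [hright] using (hzero _ hyV).1 h0)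
        have hα1 := hαα' _ hyV hsy
        rw [hright] at hα1
        have hJ : monomial J z ≠ 0 :=
          monomial_ne_zero_of_support_le (fun j hj => (hJK j hj).1) hI
        have hK : (starRingEnd ℂ) (monomial K z) ≠ 0 :=
          (map_ne_zero _).2 (monomial_ne_zero_of_support_le (fun j hj => (hJK j hj).2) hI)
        have hα2 : α'.inChart e z =
            (monomial J z * (starRingEnd ℂ) (monomial K z)) • α.inChart e z := by
          rw [CForm.inChart, ← hα1]
          rfl
        simp only [hα2, wedge_smul_left, ContinuousAlternatingMap.smul_apply, smul_eq_mul]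
        field_simp
    · rw [polarIntegrand, hχC z hzC]
      rcases hoff z hz hzC with h0 | h0
      · simp [h0]
      · have : ξ.inChart e z = 0 := by rw [CForm.inChart, h0]; rfl
        simp [this, wedge_zero]
  have hi : IntegrableOn (η.topCoeff e) e.target :=
    (integrableOn_congr_fun hcoef e.open_target.measurableSet).2 hint.integrableOn
  have hval : ∫ z in e.target, η.topCoeff e z = G lam := by
    rw [setIntegral_congr_fun e.open_target.measurableSet hcoef, hGeq]
    refine setIntegral_eq_integral_of_forall_compl_eq_zero fun z hz => ?_
    have : z ∉ C := fun hzC => hz (hCW hzC).1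
    rw [polarIntegrand, hχC z this, mul_zero, mul_zero]
  rw [← hval]
  refine CForm.hasIntegral_of_chart he (fun y hy => ?_) hi
  have : ρ y = 0 := by
    by_contra h0
    exact hy (hVe (hρV (subset_tsupport _ h0)))
  rw [hη]
  beta_reduce
  rw [this, Complex.ofReal_zero]
  exact ContinuousAlternatingMap.ext fun v => zero_mul _

end LocalContinuation

/-! ### Uniqueness of the meromorphic extension -/

section Uniqueness

/-- Two meromorphic functions which agree on a right half plane have the same orders. -/
theorem meromorphicOrderAt_eq_of_eq_halfPlane {F G : ℂ → ℂ} (hF : Meromorphic F)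
    (hG : Meromorphic G) {c : ℝ} (hFG : ∀ w : ℂ, c < w.re → F w = G w) (a : ℂ) :
    meromorphicOrderAt F a = meromorphicOrderAt G a := by
  have hD : Meromorphic (F - G) := fun w => (hF w).sub (hG w)
  have htop : meromorphicOrderAt (F - G) ((c + 1 : ℝ) : ℂ) = ⊤ := by
    rw [meromorphicOrderAt_eq_top_iff]
    refine eventually_nhdsWithin_of_eventually_nhds ?_
    have hmem : {w : ℂ | c < w.re} ∈ 𝓝 ((c + 1 : ℝ) : ℂ) :=
      (isOpen_re_gt c).mem_nhds (show c < c + 1 by linarith)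
    filter_upwards [hmem] with w hw
    simp [hFG w hw]
  -- On the connected plane, the order of a meromorphic function is infinite everywhere or nowhere.
  have ha : meromorphicOrderAt (F - G) a = ⊤ := by
    by_contra hne
    exact hD.exists_meromorphicOrderAt_ne_top_iff_forall.1 ⟨a, hne⟩ _ htop
  refine meromorphicOrderAt_congr ?_
  filter_upwards [meromorphicOrderAt_eq_top_iff.1 ha] with w hw
  exact sub_eq_zero.1 hw

end Uniqueness

/-! ### Globalization by a partition of unity -/

section Global

variable {d : ℕ} {X : Type*} [TopologicalSpace X] [ChartedSpace (Cn d) X]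
  {L : X → Type*} [TopologicalSpace (TotalSpace ℂ L)] [∀ x, AddCommGroup (L x)]
  [∀ x, Module ℂ (L x)] [∀ x, TopologicalSpace (L x)] [FiberBundle ℂ L]

theorem regularizedForm_eq_zero {k l : ℕ} (hkl : k + l = 2 * d) (h : LineBundleMetric d L)
    (s : ∀ x, L x) (α : CForm d X k) {ξ : CForm d X l} (lam : ℂ) {x : X} (hx : ξ x = 0) :
    regularizedForm hkl h s α ξ lam x = 0 := by
  rw [regularizedForm, hx, wedge_zero]
  exact ContinuousAlternatingMap.ext fun v => mul_zero _

variable [VectorBundle ℂ ℂ L]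

/-- The regularized integral has a meromorphic continuation, whose poles are controlled by the local
data at points of the support of the test form. -/
theorem exists_meromorphic_integral [T2Space X] [SecondCountableTopology X]
    [IsManifold 𝓘(ℂ, Cn d) ω X] (h : LineBundleMetric d L)
    {s : ∀ x, L x} {k l : ℕ} (hkl : k + l = 2 * d) {α : CForm d X k} {ξ : CForm d X l}
    (hξ : ξ.SmoothOn univ) (hξc : IsCompact ξ.support)
    {e : X → OpenPartialHomeomorph X (Cn d)} {I J K : X → Fin d → ℕ}
    (hloc : ∀ x, IsLocalData s α x (e x) (I x) (J x) (K x)) :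
    ∃ (G : ℂ → ℂ) (c : ℝ), Meromorphic G ∧
      (∀ lam : ℂ, c < lam.re → (regularizedForm hkl h s α ξ lam).HasIntegral (G lam)) ∧
      ∀ a : ℂ, (∀ x ∈ ξ.support, ∀ j, I x j ≠ 0 → ∀ n : ℕ,
        (I x j : ℂ) * a ≠ (min (J x j) (K x j) : ℕ) - 1 - n) → AnalyticAt ℂ G a := by
  have : IsManifold 𝓘(ℝ, Cn d) ∞ X := isManifold_real d X
  have : LocallyCompactSpace X := ChartedSpace.locallyCompactSpace (Cn d) X
  choose V hV hxV hVG using fun x => (hloc x).exists_continuation h hkl hξ hξc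
  -- The finitely many centres are taken in supp ξ, so only the multi-indices at points of supp ξ
  -- enter the description of the poles.
  obtain ⟨t, ht, htc⟩ := hξc.elim_nhds_subcover V fun x _ => (hV x).mem_nhds (hxV x)
  obtain ⟨ρ, hρ⟩ := SmoothPartitionOfUnity.exists_isSubordinate 𝓘(ℝ, Cn d) (isClosed_closure)
    (fun i : t => V i) (fun i => hV i) (s := ξ.support) (by simpa [iUnion_subtype] using htc)
  choose G c hG hGi hGa using fun i : t => hVG i (ρ i) (ρ i).contMDiff (hρ i)
  refine ⟨fun lam => ∑ i, G i lam, ∑ i, |c i|, fun a => ?_, fun lam hlam => ?_, fun a ha => ?_⟩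
  · exact MeromorphicAt.fun_sum fun i _ => hG i a
  · have hsum : regularizedForm hkl h s α ξ lam =
        ∑ i, fun y => (ρ i y : ℂ) • regularizedForm hkl h s α ξ lam y := by
      funext y
      rw [Finset.sum_apply]
      by_cases hy : y ∈ ξ.support
      · have h1 := ρ.sum_eq_one hy
        rw [finsum_eq_sum_of_fintype] at h1
        have h2 : ∑ i, (ρ i y : ℂ) = 1 := by exact_mod_cast h1
        rw [← Finset.sum_smul, h2, one_smul]
      · have h0 : ξ y = 0 := by
          by_contra hne
          exact hy (subset_closure hne)
        rw [regularizedForm_eq_zero hkl h s α lam h0]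
        exact (Finset.sum_eq_zero fun i _ =>
          ContinuousAlternatingMap.ext fun v => mul_zero _).symm
    rw [hsum]
    refine CForm.HasIntegral.sum _ fun i _ => hGi i lam (lt_of_le_of_lt ?_ hlam)
    exact (le_abs_self _).trans (Finset.single_le_sum (f := fun i => |c i|)
      (fun _ _ => abs_nonneg _) (Finset.mem_univ i))
  · exact Finset.analyticAt_fun_sum _ fun i _ => hGa i a (ha i (ht i i.2))

end Global

end QuasiMeromorphic

end

/-! ### The main theorem -/

theorem proposition2p8 {d : ℕ} {X : Type*} [TopologicalSpace X] [T2Space X]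
    [SecondCountableTopology X] [ChartedSpace (QuasiMeromorphic.Cn d) X]
    [IsManifold 𝓘(ℂ, QuasiMeromorphic.Cn d) ω X]
    {L : X → Type*} [TopologicalSpace (TotalSpace ℂ L)] [∀ x, AddCommGroup (L x)]
    [∀ x, Module ℂ (L x)] [∀ x, TopologicalSpace (L x)] [FiberBundle ℂ L] [VectorBundle ℂ ℂ L]
    [ContMDiffVectorBundle ω ℂ L 𝓘(ℂ, QuasiMeromorphic.Cn d)]
    -- the metric and the holomorphic section of `L`
    (h : QuasiMeromorphic.LineBundleMetric d L) (s : ∀ x, L x)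
    (hs : ContMDiff 𝓘(ℂ, QuasiMeromorphic.Cn d) (𝓘(ℂ, QuasiMeromorphic.Cn d).prod 𝓘(ℂ, ℂ)) ω
      (fun x => TotalSpace.mk' ℂ x (s x)))
    -- the quasi-meromorphic form with poles along `D = {s = 0}`, and the test form
    {k l : ℕ} (hkl : k + l = 2 * d) (α : QuasiMeromorphic.CForm d X k)
    (hα : QuasiMeromorphic.IsQuasiMeromorphic {x | s x = 0} α)
    (ξ : QuasiMeromorphic.CForm d X l) (hξ : ξ.SmoothOn univ) (hξc : IsCompact ξ.support)
    -- `D` has normal crossings; local coordinates and multi-indices around each point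
    (e : X → OpenPartialHomeomorph X (QuasiMeromorphic.Cn d)) (I J K : X → Fin d → ℕ)
    (hloc : ∀ x, QuasiMeromorphic.IsLocalData s α x (e x) (I x) (J x) (K x))
    -- the number `o_ω(s)`
    (o : ℕ)
    (ho : IsGreatest (range fun x => QuasiMeromorphic.localOrder (I x) (J x) (K x)) o) :
    (∃ G : ℂ → ℂ, QuasiMeromorphic.IsMeromorphicExtension hkl h s α ξ o G) ∧
    ∀ G : ℂ → ℂ, QuasiMeromorphic.IsMeromorphicExtension hkl h s α ξ o G →
      (∀ a : ℂ, QuasiMeromorphic.IsPole G a →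
        ∃ q : ℚ, a = q ∧ ∃ x ∈ ξ.support, ∃ j : Fin d, I x j ≠ 0 ∧
          q ≤ min (((J x j : ℚ) - 1) / (I x j : ℚ)) (((K x j : ℚ) - 1) / (I x j : ℚ))) ∧
      ((∀ x ∈ ξ.support, ∀ j : Fin d, J x j ≤ 1 ∨ K x j ≤ 1) →
        ∀ a : ℂ, 0 < a.re → ¬ QuasiMeromorphic.IsPole G a) := by
  -- The maximum o is attained at some point. A nonempty X is what the uniqueness of the integral
  -- requires.
  have : Nonempty X := ⟨ho.1.choose⟩
  obtain ⟨G₀, c₀, hG₀, hint, hana⟩ :=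
    QuasiMeromorphic.exists_meromorphic_integral h hkl hξ hξc hloc
  have hval : ∀ lam : ℂ, c₀ < lam.re →
      o * G₀ lam = QuasiMeromorphic.zetaF hkl h s α ξ o lam := fun lam hlam => by
    rw [QuasiMeromorphic.zetaF, (hint lam hlam).integral_eq]
  have hmer : Meromorphic fun lam => o * G₀ lam := fun a =>
    (MeromorphicAt.const (o : ℂ) a).mul (hG₀ a)
  have hpole : ∀ G : ℂ → ℂ, QuasiMeromorphic.IsMeromorphicExtension hkl h s α ξ o G →
      ∀ a : ℂ, QuasiMeromorphic.IsPole G a →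
        ∃ q : ℚ, a = q ∧ ∃ x ∈ ξ.support, ∃ j : Fin d, I x j ≠ 0 ∧
          q ≤ min (((J x j : ℚ) - 1) / (I x j : ℚ)) (((K x j : ℚ) - 1) / (I x j : ℚ)) := by
    rintro G ⟨hG, c, hc⟩ a ha
    rw [QuasiMeromorphic.IsPole, QuasiMeromorphic.meromorphicOrderAt_eq_of_eq_halfPlane hG hmer
      (c := max c c₀) (fun w hw => by
        rw [(hc w ((le_max_left _ _).trans_lt hw)).2, hval w ((le_max_right _ _).trans_lt hw)])]
      at ha
    by_contra hcon
    -- A coincidence I_j a = min(J_j, K_j) - 1 - n would give a = (min(J_j, K_j) - 1 - n)/I_j, a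
    -- rational number within the asserted bound; otherwise a is not a pole.
    have hG₀a : AnalyticAt ℂ G₀ a := hana a fun x hx j hj n hn => hcon
      ⟨((min (J x j) (K x j) : ℕ) - 1 - n) / I x j, ?_, x, hx, j, hj, ?_⟩
    · exact ha.not_ge (analyticAt_const.mul hG₀a).meromorphicOrderAt_nonneg
    · have hI : (I x j : ℂ) ≠ 0 := Nat.cast_ne_zero.2 hj
      simp only [Rat.cast_div, Rat.cast_sub, Rat.cast_natCast, Rat.cast_one]
      rw [eq_div_iff hI, mul_comm, hn]
    · rw [min_div_div_right (Nat.cast_nonneg _), min_sub_sub_right]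
      rw [Nat.cast_min]
      exact div_le_div_of_nonneg_right (sub_le_self _ n.cast_nonneg) (Nat.cast_nonneg _)
  refine ⟨⟨fun lam => o * G₀ lam, hmer, c₀, fun lam hlam => ⟨⟨_, hint lam hlam⟩, hval lam hlam⟩⟩,
    fun G hG => ⟨hpole G hG, fun hJK a ha hp => ?_⟩⟩
  obtain ⟨q, rfl, x, hx, j, hj, hq⟩ := hpole G hG a hp
  have hq0 : (0 : ℚ) < q := by simpa using ha
  have hI : (0 : ℚ) ≤ I x j := Nat.cast_nonneg _
  -- If J_j ≤ 1 or K_j ≤ 1, one of the two quotients in the minimum is nonpositive, contradicting q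
  -- > 0.
  rcases hJK x hx j with h1 | h1
  · refine absurd (hq.trans (min_le_left _ _)) (not_le.2 (lt_of_le_of_lt ?_ hq0))
    exact div_nonpos_of_nonpos_of_nonneg (sub_nonpos.2 (by exact_mod_cast h1)) hI
  · refine absurd (hq.trans (min_le_right _ _)) (not_le.2 (lt_of_le_of_lt ?_ hq0))
    exact div_nonpos_of_nonpos_of_nonneg (sub_nonpos.2 (by exact_mod_cast h1)) hI
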